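/- For a point $u$ in the plane, the six rays from $u$ at angles $j\pi/3$ ($j=0,\dots,5$) from the positive $x$-axis bound six cones with apex $u$. The three \emph{positive cones} of $u$ are $C_i^u$, $i=0,1,2$, the region between the rays at angles $(2i+1)\pi/3$ and $(2i+2)\pi/3$. Let $P$ be a finite set of points in the plane in \emph{general position}, i.e. no two points of $P$ lie on a line parallel to a cone boundary. The \emph{half-$\theta_6$-graph} of $P$ has vertex set $P$; each $u\in P$ is joined, in each of its positive cones that contains a point of $P$, to the point of $P$ in that cone whose orthogonal projection on the bisector of the cone is closest to $u$. Edges have their Euclidean length. For an integer $k\ge 0$, let $N_k(s)$ be the set of vertices that can be reached from $s$ by following at most $k$ edges. A \emph{deterministic $k$-local $0$-memory routing algorithm} is a function $A$ that, from the current vertex $s$, the destination $t$ and the set $N_k(s)$ alone, determines the vertex to which the message is forwarded. Routing from $s$ to $t$ iterates $A$ until the message is at $t$; it succeeds if the message follows edges of the graph and arrives at $t$ after finitely many steps, and the length of the path followed is the sum of the lengths of these edges (it is regarded as infinite if the routing does not succeed). For $w$ in a positive cone of $u$, let $T_{uw}$ be the triangle bounded by that cone and by the line through $w$ perpendicular to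 the bisector of the cone, let $m$ be the midpoint of the side of $T_{uw}$ opposite $u$, and let $\alpha$ be the unsigned angle between $uw$ and $um$. \textbf{Upper bounds.} There is a deterministic $1$-local $0$-memory routing algorithm such that, for every finite point set $P$ in general position and all $u,w\in P$ with $w$ in a positive cone of $u$, the algorithm on the half-$\theta_6$-graph of $P$ succeeds in both directions, and the path followed has length at most \begin{enumerate} \item $\left(\sqrt3\cos\alpha+\sin\alpha\right)|uw|$ when routing from $u$ to $w$, \item $\left(\tfrac{5}{\sqrt3}\cos\alpha-\sin\alpha\right)|uw|$ when routing from $w$ to $u$. \end{enumerate} \textbf{Optimality.} Both bounds are best possible for deterministic $k$-local $0$-memory routing algorithms, for every constant $k$: for every $k$, every such algorithm, and all points $u,w$ with $w$ in the interior of a positive cone of $u$, \begin{enumerate} \item for every real $L<\left(\sqrt3\cos\alpha+\sin\alpha\right)|uw|$ there is a finite point set $P\ni u,w$ in general position such that the path followed on the half-$\theta_6$-graph of $P$ when routing from $u$ to $w$ has length greater than $L$; \item for every real $L<\left(\tfrac{5}{\sqrt3}\cos\alpha-\sin\alpha\right)|uw|$ there is a finite point set $P\ni u,w$ in general position such that the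 path followed on the half-$\theta_6$-graph of $P$ when routing from $w$ to $u$ has length greater than $L$. \end{enumerate} -/

import Mathlib

open scoped RealInnerProductSpace

noncomputable section

namespace HalfThetaSix

/-- The Euclidean plane. -/
abbrev Plane : Type := EuclideanSpace ℝ (Fin 2)

/-- The unit vector at angle `φ` (counter-clockwise) from the positive `x`-axis. -/
def unitVec (φ : ℝ) : Plane := !₂[Real.cos φ, Real.sin φ]

/-- Direction of the `j`-th cone boundary: the ray at angle `j * π / 3`. -/
def ray (j : ℕ) : Plane := unitVec (j * (Real.pi / 3))

/-- The positive cone `C_i` with apex `u`. In counter-clockwise order from the positive `x`-axis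
the six cones are `C̄₁, C₀, C̄₂, C₁, C̄₀, C₂`, so `C_i` is the region between the rays
number `2 * i + 1` and `2 * i + 2`. Points on a cone boundary never occur in a point set in
general position, so the open region is used. -/
def positiveCone (i : Fin 3) (u : Plane) : Set Plane :=
  {v | ∃ a b : ℝ, 0 < a ∧ 0 < b ∧
    v - u = a • ray (2 * (i : ℕ) + 1) + b • ray (2 * (i : ℕ) + 2)}

/-- The unit vector along the bisector of the positive cone `C_i`. -/
def bisector (i : Fin 3) : Plane := unitVec ((2 * (i : ℕ) + 3 / 2) * (Real.pi / 3))

/-- Signed length of the projection of `v - u` onto the bisector of `C_i`. -/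
def coneDist (i : Fin 3) (u v : Plane) : ℝ := ⟪bisector i, v - u⟫

/-- No two points of `P` lie on a line parallel to a cone boundary. -/
def GeneralPosition (P : Finset Plane) : Prop :=
  ∀ u ∈ P, ∀ v ∈ P, u ≠ v → ∀ (j : ℕ) (c : ℝ), v - u ≠ c • ray j

/-- `v` is a vertex of `P` in the positive cone `C_i` of `u` whose projection on the bisector of
that cone is closest to `u`. -/
def IsClosest (P : Finset Plane) (i : Fin 3) (u v : Plane) : Prop :=
  v ∈ P ∧ v ∈ positiveCone i u ∧
    ∀ x ∈ P, x ∈ positiveCone i u → coneDist i u v ≤ coneDist i u x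

/-- The half-`θ₆`-graph of `P`, as a graph on the plane whose edges all join points of `P`: every
`u ∈ P` is joined to the closest vertex in each of its positive cones. -/
def halfTheta6 (P : Finset Plane) : SimpleGraph Plane where
  Adj u v := u ≠ v ∧ u ∈ P ∧ v ∈ P ∧ ∃ i : Fin 3, IsClosest P i u v ∨ IsClosest P i v u
  symm := ⟨fun _ _ ⟨hne, hu, hv, i, h⟩ => ⟨hne.symm, hv, hu, i, h.symm⟩⟩
  loopless := ⟨fun _ h => h.1 rfl⟩

/-- The `k`-neighbourhood `N_k(s)`: the vertices that can be reached from `s` by following at most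
`k` edges of the half-`θ₆`-graph of `P`. -/
def kNeighborhood (P : Finset Plane) (k : ℕ) (s : Plane) : Set Plane :=
  {v | ∃ p : (halfTheta6 P).Walk s v, p.length ≤ k}

/-- The decision function of a deterministic local 0-memory routing algorithm: from the current
vertex `s`, the destination `t` and the set of vertices seen from `s`, it determines the vertex to
which the message is forwarded. It is used as a `k`-local algorithm by feeding it `N_k(s)`. -/
abbrev RoutingAlgorithm : Type := Plane → Plane → Set Plane → Plane

/-- The vertex that holds the message after `n` steps, when the algorithm `A`, used as a `k`-local
algorithm on the half-`θ₆`-graph of `P`, routes from `s` to `t`. -/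
def position (A : RoutingAlgorithm) (k : ℕ) (P : Finset Plane) (s t : Plane) : ℕ → Plane
  | 0 => s
  | n + 1 => A (position A k P s t n) t (kNeighborhood P k (position A k P s t n))

/-- When routing from `s` to `t`, the message follows edges of the graph and arrives at `t` for the
first time after exactly `n` steps. -/
def ArrivesAfter (A : RoutingAlgorithm) (k : ℕ) (P : Finset Plane) (s t : Plane) (n : ℕ) : Prop :=
  position A k P s t n = t ∧
    ∀ j < n, position A k P s t j ≠ t ∧
      (halfTheta6 P).Adj (position A k P s t j) (position A k P s t (j + 1))

/-- The distance travelled by the message during the first `n` steps. -/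
def travelled (A : RoutingAlgorithm) (k : ℕ) (P : Finset Plane) (s t : Plane) (n : ℕ) : ℝ :=
  ∑ j ∈ Finset.range n, dist (position A k P s t j) (position A k P s t (j + 1))

/-- For `w` in the positive cone `C_i` of `u`, the corner on the boundary ray number `j`
(`j = 2 * i + 1` or `j = 2 * i + 2`) of the canonical triangle `T_{uw}`, which is bounded by the cone
and the line through `w` perpendicular to its bisector: it is the point of that ray whose
projection on the bisector agrees with that of `w`. -/
def canonicalCorner (i : Fin 3) (j : ℕ) (u w : Plane) : Plane :=
  u + (coneDist i u w / ⟪bisector i, ray j⟫) • ray j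

/-- The midpoint `m` of the side of the canonical triangle `T_{uw}` opposing `u`. -/
def oppositeMidpoint (i : Fin 3) (u w : Plane) : Plane :=
  midpoint ℝ (canonicalCorner i (2 * (i : ℕ) + 1) u w) (canonicalCorner i (2 * (i : ℕ) + 2) u w)

/-- The unsigned angle `α` between `uw` and `um`. -/
def canonicalAngle (i : Fin 3) (u w : Plane) : ℝ :=
  EuclideanGeometry.angle w u (oppositeMidpoint i u w)

/-- `(√3 cos α + sin α) |uw|`. -/
def positiveBound (i : Fin 3) (u w : Plane) : ℝ :=
  (√3 * Real.cos (canonicalAngle i u w) + Real.sin (canonicalAngle i u w)) * dist u w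

/-- `(5/√3 cos α - sin α) |uw|`. -/
def negativeBound (i : Fin 3) (u w : Plane) : ℝ :=
  (5 / √3 * Real.cos (canonicalAngle i u w) - Real.sin (canonicalAngle i u w)) * dist u w

end HalfThetaSix

end

open HalfThetaSix

/-! In the triangular coordinates `crd`, which sum to zero, the problem becomes linear. The cone
`C_i` of `u` is where the two other coordinates drop, closeness inside it means small `crd i`, and a
segment in `C_i` is at most as long as the rise of `crd i` (`dist_le`). If `D` is the rise of `crd
i` from `u` to `w`, and `a + b = D` are the drops of the other two coordinates, the bounds read `D +
max a b` and `2 * D + min a b`.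

Upper bounds: every move is paid for by a potential (`Step.spec`). If `t` is in a positive cone of
`s`, the potential is `D + max a b` and the message goes to the closest vertex of that cone. If `s`
is in `C_i` of `t`, the canonical triangle of `t` and `s` meets the two other positive cones of `s`
in two pockets. When both are occupied, the message enters the one at the nearer corner, with
potential `2 * D + min a b`. When pocket `k` is empty, no detour back across the triangle is needed:
the message keeps to the side `j`, with potential `D` plus the length to the corner on that side.
Emptiness of the pocket is inherited by the next vertex (`Descend.spec`) and is visible locally, so
it replaces memory. A move towards a positive cone that overshoots also leaves an empty pocket
(`potential_of_isClosest`).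

Lower bounds: from `u`, one extra point near the farther upper corner is the only neighbour of `u`
and forces the detour. From `w`, a long zigzag of points near the two upper corners hides from `w`
which side holds the only neighbour of `u`. One more point switches that side without changing the
`k`-neighbourhood of `w`, so the first move can always be made the wrong one. -/

namespace HalfThetaSix

/-! ### Triangular coordinates -/

/-- The `i`-th triangular coordinate: the projection on the bisector of the cone `C_i`, scaled so
that the side of a canonical triangle is a difference of coordinates. -/
noncomputable def crd (i : Fin 3) (p : Plane) : ℝ := 2 / √3 * ⟪bisector i, p⟫

lemma inv_sqrt_three : (√3)⁻¹ = √3 / 3 := by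
  have h : √3 * √3 = 3 := Real.mul_self_sqrt (by norm_num)
  have h0 : √3 ≠ 0 := by positivity
  field_simp
  linarith

lemma inner_unitVec (φ : ℝ) (p : Plane) : ⟪unitVec φ, p⟫ = Real.cos φ * p 0 + Real.sin φ * p 1 := by
  simp [unitVec, PiLp.inner_apply, Fin.sum_univ_two, mul_comm]

lemma bisector_zero : bisector 0 = unitVec (Real.pi / 2) := by
  unfold bisector; congr 1; push_cast [Fin.val_zero]; ring

lemma bisector_one : bisector 1 = unitVec (Real.pi / 6 + Real.pi) := by
  unfold bisector; congr 1; simp; ring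

lemma bisector_two : bisector 2 = unitVec (-(Real.pi / 6) + 2 * Real.pi) := by
  unfold bisector; congr 1; simp; ring

lemma crd_zero (p : Plane) : crd 0 p = 2 * √3 / 3 * p 1 := by
  rw [crd, bisector_zero, inner_unitVec, Real.cos_pi_div_two, Real.sin_pi_div_two,
    div_eq_mul_inv, inv_sqrt_three]
  ring

lemma crd_one (p : Plane) : crd 1 p = -p 0 - √3 / 3 * p 1 := by
  have h : √3 * √3 = 3 := Real.mul_self_sqrt (by norm_num)
  rw [crd, bisector_one, inner_unitVec, Real.cos_add_pi, Real.sin_add_pi, Real.cos_pi_div_six,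
    Real.sin_pi_div_six, div_eq_mul_inv, inv_sqrt_three]
  linear_combination (-p 0 / 3) * h

lemma crd_two (p : Plane) : crd 2 p = p 0 - √3 / 3 * p 1 := by
  have h : √3 * √3 = 3 := Real.mul_self_sqrt (by norm_num)
  rw [crd, bisector_two, inner_unitVec, Real.cos_add_two_pi, Real.sin_add_two_pi, Real.cos_neg,
    Real.sin_neg, Real.cos_pi_div_six, Real.sin_pi_div_six, div_eq_mul_inv, inv_sqrt_three]
  linear_combination (p 0 / 3) * h

lemma crd_sub (i : Fin 3) (p q : Plane) : crd i (p - q) = crd i p - crd i q := by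
  simp only [crd, inner_sub_right]; ring

lemma crd_add (i : Fin 3) (p q : Plane) : crd i (p + q) = crd i p + crd i q := by
  simp only [crd, inner_add_right]; ring

lemma crd_smul (i : Fin 3) (c : ℝ) (p : Plane) : crd i (c • p) = c * crd i p := by
  simp only [crd, inner_smul_right]; ring

lemma coneDist_eq (i : Fin 3) (u v : Plane) :
    coneDist i u v = √3 / 2 * (crd i v - crd i u) := by
  have h0 : √3 ≠ 0 := by positivity
  rw [← crd_sub, crd, coneDist]
  field_simp

lemma coneDist_le_iff (i : Fin 3) (u v x : Plane) :
    coneDist i u v ≤ coneDist i u x ↔ crd i v ≤ crd i x := by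
  have h0 : 0 < √3 / 2 := by positivity
  rw [coneDist_eq, coneDist_eq, mul_le_mul_iff_right₀ h0]
  exact sub_le_sub_iff_right _

lemma crd_sum_univ (p : Plane) : crd 0 p + crd 1 p + crd 2 p = 0 := by
  rw [crd_zero, crd_one, crd_two]; ring

/-- `i`, `j`, `k` are the three indices, in some order. -/
def Distinct (i j k : Fin 3) : Prop := i ≠ j ∧ i ≠ k ∧ j ≠ k

lemma Distinct.swap {i j k : Fin 3} (h : Distinct i j k) : Distinct i k j :=
  ⟨h.2.1, h.1, h.2.2.symm⟩

lemma Distinct.rotate {i j k : Fin 3} (h : Distinct i j k) : Distinct j k i :=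
  ⟨h.2.2, h.1.symm, h.2.1.symm⟩

lemma distinct_add (i : Fin 3) : Distinct i (i + 1) (i + 2) := by
  unfold Distinct; revert i; decide

lemma Distinct.eq_or {i j k : Fin 3} (h : Distinct i j k) (l : Fin 3) : l = i ∨ l = j ∨ l = k := by
  unfold Distinct at h; revert i j k l; decide

lemma Distinct.eq_or_swap {i j k j' k' : Fin 3} (h : Distinct i j k) (h' : Distinct i j' k') :
    (j' = j ∧ k' = k) ∨ (j' = k ∧ k' = j) := by
  unfold Distinct at h h'; revert i j k j' k'; decide

lemma crd_sum {i j k : Fin 3} (h : Distinct i j k) (p : Plane) :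
    crd i p + crd j p + crd k p = 0 := by
  have := crd_sum_univ p
  obtain ⟨h1, h2, h3⟩ := h
  fin_cases i <;> fin_cases j <;> fin_cases k <;> simp_all <;> linarith

/-- The point with prescribed coordinates. -/
lemma exists_crd {i j k : Fin 3} (h : Distinct i j k) (x y : ℝ) :
    ∃ p : Plane, crd i p = x ∧ crd j p = y ∧ crd k p = -x - y := by
  have h3 : √3 * √3 = 3 := Real.mul_self_sqrt (by norm_num)
  have key : ∀ f : Fin 3 → ℝ, f 0 + f 1 + f 2 = 0 → ∃ p : Plane, ∀ l, crd l p = f l := by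
    intro f hf
    refine ⟨!₂[(f 2 - f 1) / 2, √3 / 2 * f 0], fun l => ?_⟩
    fin_cases l
    · simp [crd_zero]; linear_combination (f 0 / 3) * h3
    · simp [crd_one]; linear_combination (-f 0 / 6) * h3 - hf / 2
    · simp [crd_two]; linear_combination (-f 0 / 6) * h3 - hf / 2
  obtain ⟨p, hp⟩ := key (fun l => if l = i then x else if l = j then y else -x - y) (by
    obtain ⟨h1, h2, h3⟩ := h
    fin_cases i <;> fin_cases j <;> fin_cases k <;> simp_all <;> ring)
  refine ⟨p, ?_, ?_, ?_⟩
  · simp [hp]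
  · simp [hp, h.1.symm]
  · simp [hp, h.2.1.symm, h.2.2.symm]

lemma dist_sq_eq {i j k : Fin 3} (h : Distinct i j k) (p q : Plane) :
    dist p q ^ 2 = ((crd i p - crd i q) ^ 2 + (crd j p - crd j q) ^ 2
      + (crd k p - crd k q) ^ 2) / 2 := by
  have h3 : √3 * √3 = 3 := Real.mul_self_sqrt (by norm_num)
  have key : dist p q ^ 2 = ((crd 0 p - crd 0 q) ^ 2 + (crd 1 p - crd 1 q) ^ 2
      + (crd 2 p - crd 2 q) ^ 2) / 2 := by
    rw [EuclideanSpace.dist_eq, Real.sq_sqrt (by positivity), Fin.sum_univ_two, Real.dist_eq,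
      Real.dist_eq, sq_abs, sq_abs]
    simp only [crd_zero, crd_one, crd_two]
    linear_combination (-(p 1 - q 1) ^ 2 / 3) * h3
  rw [key]
  obtain ⟨h1, h2, h3⟩ := h
  fin_cases i <;> fin_cases j <;> fin_cases k <;> simp_all <;> ring

lemma eq_of_crd {i j k : Fin 3} (h : Distinct i j k) {p q : Plane} (hi : crd i p = crd i q)
    (hj : crd j p = crd j q) : p = q := by
  have hp := crd_sum h p
  have hq := crd_sum h q
  have hk : crd k p = crd k q := by linarith
  have := dist_sq_eq h p q
  rw [hi, hj, hk] at this
  simpa using this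

/-- The projection on a line parallel to a cone boundary bounds the distance from below. -/
lemma le_dist {i j k : Fin 3} (h : Distinct i j k) (p q : Plane) :
    ((crd j p - crd j q) - (crd k p - crd k q)) / 2 ≤ dist p q := by
  refine le_of_abs_le (abs_le_of_sq_le_sq ?_ dist_nonneg)
  have hp := crd_sum h p
  have hq := crd_sum h q
  have : crd i p - crd i q = -(crd j p - crd j q) - (crd k p - crd k q) := by linarith
  rw [dist_sq_eq h, this]
  nlinarith [sq_nonneg (crd j p - crd j q + (crd k p - crd k q))]

/-- Going along two cone boundaries is longer than the straight segment. -/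
lemma dist_le {i j k : Fin 3} (h : Distinct i j k) {p q : Plane} (hj : crd j q ≤ crd j p)
    (hk : crd k q ≤ crd k p) : dist p q ≤ crd i q - crd i p := by
  have hp := crd_sum h p
  have hq := crd_sum h q
  have : crd i p - crd i q = -(crd j p - crd j q) - (crd k p - crd k q) := by linarith
  refine le_of_abs_le (abs_le_of_sq_le_sq ?_ (by linarith))
  rw [dist_sq_eq h, this, ← neg_sub (crd i p), this]
  nlinarith [mul_nonneg (sub_nonneg.2 hj) (sub_nonneg.2 hk)]

/-! ### Cones, general position and the bounds in coordinates -/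

lemma crd_ray (i : Fin 3) (j : ℕ) :
    crd i (ray j) = 2 / √3 * Real.cos ((2 * (i : ℕ) + 3 / 2 - j) * (Real.pi / 3)) := by
  rw [crd, bisector, ray, inner_unitVec, sub_mul, Real.cos_sub]
  simp [unitVec]

lemma two_div_sqrt_three_mul : 2 / √3 * (√3 / 2) = 1 := by
  have h0 : √3 ≠ 0 := by positivity
  field_simp

lemma crd_ray_self_left (i : Fin 3) : crd i (ray (2 * i + 1)) = 1 := by
  rw [crd_ray, ← two_div_sqrt_three_mul, ← Real.cos_pi_div_six]
  congr 2; push_cast; ring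

lemma crd_ray_self_right (i : Fin 3) : crd i (ray (2 * i + 2)) = 1 := by
  rw [crd_ray, ← two_div_sqrt_three_mul, ← Real.cos_pi_div_six, ← Real.cos_neg]
  congr 2; push_cast; ring

lemma crd_ray_eq_zero {i : Fin 3} {j : ℕ} (h : (3 : ℤ) ∣ 2 * (i : ℕ) - j) : crd i (ray j) = 0 := by
  obtain ⟨m, h⟩ := h
  have h' : (2 * (i : ℕ) : ℝ) - j = 3 * m := by exact_mod_cast h
  have : (2 * (i : ℕ) + 3 / 2 - j) * (Real.pi / 3) = Real.pi / 2 + m * Real.pi := by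
    linear_combination (Real.pi / 3) * h'
  rw [crd_ray, this, Real.cos_add_int_mul_pi, Real.cos_pi_div_two]
  simp

lemma exists_crd_ray_eq_zero (j : ℕ) : ∃ i, crd i (ray j) = 0 := by
  rcases (show j % 3 = 0 ∨ j % 3 = 1 ∨ j % 3 = 2 by omega) with h | h | h
  · exact ⟨0, crd_ray_eq_zero (by push_cast [Fin.val_zero]; omega)⟩
  · exact ⟨2, crd_ray_eq_zero (by push_cast [Fin.val_two]; omega)⟩
  · exact ⟨1, crd_ray_eq_zero (by push_cast [Fin.val_one]; omega)⟩

lemma crd_ray_left (i : Fin 3) :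
    crd (i + 1) (ray (2 * i + 1)) = -1 ∧ crd (i + 2) (ray (2 * i + 1)) = 0 := by
  have h0 : crd (i + 2) (ray (2 * i + 1)) = 0 := crd_ray_eq_zero (by revert i; decide)
  have := crd_sum (distinct_add i) (ray (2 * i + 1))
  rw [crd_ray_self_left, h0] at this
  exact ⟨by linarith, h0⟩

lemma crd_ray_right (i : Fin 3) :
    crd (i + 1) (ray (2 * i + 2)) = 0 ∧ crd (i + 2) (ray (2 * i + 2)) = -1 := by
  have h0 : crd (i + 1) (ray (2 * i + 2)) = 0 := crd_ray_eq_zero (by revert i; decide)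
  have := crd_sum (distinct_add i) (ray (2 * i + 2))
  rw [crd_ray_self_right, h0] at this
  exact ⟨h0, by linarith⟩

/-- The boundary rays of `C_i` have coordinates `(1, -1, 0)` and `(1, 0, -1)` in the order `i, i +
1, i + 2`, so the coefficients `a`, `b` of a point of the cone are the drops of the two other
coordinates. -/
lemma mem_positiveCone {i j k : Fin 3} (h : Distinct i j k) {u v : Plane} :
    v ∈ positiveCone i u ↔ crd j v < crd j u ∧ crd k v < crd k u := by
  have key : v ∈ positiveCone i u ↔ crd (i + 1) v < crd (i + 1) u ∧ crd (i + 2) v < crd (i + 2) u := by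
    obtain ⟨l1, l2⟩ := crd_ray_left i
    obtain ⟨r1, r2⟩ := crd_ray_right i
    constructor
    · rintro ⟨a, b, ha, hb, hv⟩
      have h1 := congrArg (crd (i + 1)) hv
      have h2 := congrArg (crd (i + 2)) hv
      simp only [crd_sub, crd_add, crd_smul, l1, l2, r1, r2] at h1 h2
      constructor <;> linarith
    · rintro ⟨h1, h2⟩
      refine ⟨crd (i + 1) u - crd (i + 1) v, crd (i + 2) u - crd (i + 2) v, by linarith,
        by linarith, eq_of_crd (distinct_add i).rotate ?_ ?_⟩ <;>
      simp only [crd_sub, crd_add, crd_smul, l1, l2, r1, r2] <;> ring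
  rw [key]
  rcases (distinct_add i).eq_or_swap h with ⟨rfl, rfl⟩ | ⟨rfl, rfl⟩
  · rfl
  · exact and_comm

lemma generalPosition_iff {P : Finset Plane} :
    GeneralPosition P ↔ ∀ u ∈ P, ∀ v ∈ P, u ≠ v → ∀ i, crd i u ≠ crd i v := by
  constructor
  · intro h u hu v hv huv i hi
    have hd := distinct_add i
    -- This ray is parallel to the lines on which `crd i` is constant.
    have hr := crd_ray_right (i + 2)
    rw [show i + 2 + 1 = i by grind, show i + 2 + 2 = i + 1 by grind] at hr
    refine h u hu v hv huv (2 * (i + 2 : Fin 3) + 2) (crd (i + 1) u - crd (i + 1) v)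
      (eq_of_crd hd ?_ ?_) <;> simp only [crd_sub, crd_smul, hr.1, hr.2, hi] <;> ring
  · intro h u hu v hv huv j c hc
    obtain ⟨i, hi⟩ := exists_crd_ray_eq_zero j
    have := congrArg (crd i) hc
    rw [crd_sub, crd_smul, hi, mul_zero, sub_eq_zero] at this
    exact h u hu v hv huv i this.symm

/-! ### The two bounds as linear expressions in the coordinates. -/

lemma inner_bisector_eq (i : Fin 3) (p : Plane) : ⟪bisector i, p⟫ = √3 / 2 * crd i p := by
  have h0 : √3 ≠ 0 := by positivity
  rw [crd]
  field_simp

lemma norm_sq_eq {i j k : Fin 3} (h : Distinct i j k) (p : Plane) :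
    ‖p‖ ^ 2 = (crd i p ^ 2 + crd j p ^ 2 + crd k p ^ 2) / 2 := by
  have := dist_sq_eq h p 0
  simpa [crd] using this

lemma inner_eq {i j k : Fin 3} (h : Distinct i j k) (p q : Plane) :
    ⟪p, q⟫ = (crd i p * crd i q + crd j p * crd j q + crd k p * crd k q) / 2 := by
  rw [real_inner_eq_norm_add_mul_self_sub_norm_mul_self_sub_norm_mul_self_div_two]
  simp only [← sq, norm_sq_eq h, crd_add]
  ring

lemma crd_oppositeMidpoint_sub (i : Fin 3) (u w : Plane) :
    crd i (oppositeMidpoint i u w - u) = crd i w - crd i u ∧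
    crd (i + 1) (oppositeMidpoint i u w - u) = -(crd i w - crd i u) / 2 ∧
    crd (i + 2) (oppositeMidpoint i u w - u) = -(crd i w - crd i u) / 2 := by
  have h0 : √3 / 2 ≠ 0 := by positivity
  obtain ⟨l1, l2⟩ := crd_ray_left i
  obtain ⟨r1, r2⟩ := crd_ray_right i
  simp only [oppositeMidpoint, midpoint_eq_smul_add, canonicalCorner, coneDist_eq,
    inner_bisector_eq, crd_ray_self_left, crd_ray_self_right, crd_sub, crd_add, crd_smul, mul_one,
    mul_div_cancel_left₀ _ h0, l1, l2, r1, r2, invOf_eq_inv]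
  refine ⟨?_, ?_, ?_⟩ <;> ring

/-- The segment `um` is the altitude of an equilateral triangle of side `D`. The cosine part is that
altitude, and the sine part is the distance from `w` to `m` along the opposite side. -/
lemma cos_sin_canonicalAngle {i j k : Fin 3} (h : Distinct i j k) {u w : Plane}
    (hw : w ∈ positiveCone i u) :
    Real.cos (canonicalAngle i u w) * dist u w = √3 / 2 * (crd i w - crd i u) ∧
    Real.sin (canonicalAngle i u w) * dist u w
      = |(crd j w - crd j u) - (crd k w - crd k u)| / 2 := by
  have h3 : √3 * √3 = 3 := Real.mul_self_sqrt (by norm_num)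
  have hd := distinct_add i
  obtain ⟨m0, m1, m2⟩ := crd_oppositeMidpoint_sub i u w
  rw [mem_positiveCone hd] at hw
  have hu := crd_sum hd u
  have hw' := crd_sum hd w
  set D := crd i w - crd i u with hD
  have hDpos : 0 < D := by linarith [hw.1, hw.2]
  set m := oppositeMidpoint i u w - u with hm
  have hnm : ‖m‖ = √3 / 2 * D := by
    rw [← sq_eq_sq₀ (norm_nonneg _) (by positivity), norm_sq_eq hd, m0, m1, m2]
    linear_combination (-D ^ 2 / 4) * h3
  have hpos : 0 < ‖m‖ := by rw [hnm]; positivity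
  have hang : canonicalAngle i u w = InnerProductGeometry.angle (w - u) m := rfl
  have hdist : dist u w = ‖w - u‖ := by rw [dist_comm, dist_eq_norm]
  have hin : ⟪w - u, m⟫ = 3 / 4 * D ^ 2 := by
    rw [inner_eq hd, m0, m1, m2]
    simp only [crd_sub, ← hD]
    linear_combination (-D / 4) * (hw' - hu) + D / 4 * hD
  have hjk : |(crd j w - crd j u) - (crd k w - crd k u)|
      = |(crd (i + 1) w - crd (i + 1) u) - (crd (i + 2) w - crd (i + 2) u)| := by
    rcases hd.eq_or_swap h with ⟨rfl, rfl⟩ | ⟨rfl, rfl⟩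
    · rfl
    · rw [← abs_neg]; congr 1; ring
  constructor
  · have := InnerProductGeometry.cos_angle_mul_norm_mul_norm (w - u) m
    rw [hang, hdist]
    apply mul_right_cancel₀ hpos.ne'
    rw [mul_assoc, this, hin, hnm]
    linear_combination (-D ^ 2 / 4) * h3
  · have := InnerProductGeometry.sin_angle_mul_norm_mul_norm (w - u) m
    rw [hang, hdist, hjk]
    apply mul_right_cancel₀ hpos.ne'
    rw [mul_assoc, this, hin, real_inner_self_eq_norm_sq, real_inner_self_eq_norm_sq]
    have hsum : D = -(crd (i + 1) w - crd (i + 1) u) - (crd (i + 2) w - crd (i + 2) u) := by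
      linarith
    refine (congrArg Real.sqrt ?_).trans (Real.sqrt_sq (by positivity))
    rw [mul_pow, div_pow, sq_abs, hnm, norm_sq_eq hd]
    simp only [crd_sub, ← hD]
    have h4 : (√3 / 2 * D) ^ 2 = 3 / 4 * D ^ 2 := by linear_combination (D ^ 2 / 4) * h3
    rw [h4]
    linear_combination (3 / 16 * D ^ 2 * ((crd (i + 1) w - crd (i + 1) u)
      + (crd (i + 2) w - crd (i + 2) u) - D)) * hsum

lemma positiveBound_eq {i j k : Fin 3} (h : Distinct i j k) {u w : Plane}
    (hw : w ∈ positiveCone i u) :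
    positiveBound i u w = (crd i w - crd i u) + max (crd j u - crd j w) (crd k u - crd k w) := by
  have h3 : √3 * √3 = 3 := Real.mul_self_sqrt (by norm_num)
  obtain ⟨hc, hs⟩ := cos_sin_canonicalAngle h hw
  have hu := crd_sum h u
  have hw' := crd_sum h w
  rw [positiveBound, add_mul, mul_assoc, hc, hs, max_def]
  have : √3 * (√3 / 2 * (crd i w - crd i u)) = 3 / 2 * (crd i w - crd i u) := by
    linear_combination (crd i w - crd i u) / 2 * h3
  rw [this]
  split_ifs with h1
  · rw [abs_of_nonneg (by linarith)]; linarith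
  · rw [abs_of_nonpos (by linarith)]; linarith

lemma negativeBound_eq {i j k : Fin 3} (h : Distinct i j k) {u w : Plane}
    (hw : w ∈ positiveCone i u) :
    negativeBound i u w
      = 2 * (crd i w - crd i u) + min (crd j u - crd j w) (crd k u - crd k w) := by
  have h0 : √3 ≠ 0 := by positivity
  obtain ⟨hc, hs⟩ := cos_sin_canonicalAngle h hw
  have hu := crd_sum h u
  have hw' := crd_sum h w
  rw [negativeBound, sub_mul, mul_assoc, hc, hs, min_def]
  have : 5 / √3 * (√3 / 2 * (crd i w - crd i u)) = 5 / 2 * (crd i w - crd i u) := by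
    field_simp
  rw [this]
  split_ifs with h1
  · rw [abs_of_nonneg (by linarith)]; linarith
  · rw [abs_of_nonpos (by linarith)]; linarith

end HalfThetaSix

namespace HalfThetaSix

/-! ### The routing algorithm -/

/-- `v` is a point of `N` in the cone `C_i` of `s` that is closest to `s`. -/
def Nearest (N : Set Plane) (i : Fin 3) (s v : Plane) : Prop :=
  v ∈ N ∧ v ∈ positiveCone i s ∧ ∀ x ∈ N, x ∈ positiveCone i s → crd i v ≤ crd i x

/-- `p` lies in the part of the cone `C_k` of `s` that belongs to the canonical triangle of
`t` and `s`, where `s` is in a positive cone of `t` other than `C_k`. -/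
def Pocket (k : Fin 3) (s t p : Plane) : Prop := p ∈ positiveCone k s ∧ crd k p < crd k t

/-- `x` lies in the intersection of the canonical triangle of `t` and `s` with the negative cone
of `s` that contains `t`. -/
def Below (i j k : Fin 3) (s t x : Plane) : Prop :=
  s ∈ positiveCone i x ∧ crd j x ≤ crd j t ∧ crd k x ≤ crd k t

/-- The move along the side `j` when `s` is in the cone `C_i` of `t` and the pocket `k` is
empty. -/
def Descend (i j k : Fin 3) (s t : Plane) (N : Set Plane) (v : Plane) : Prop :=
  (v ∈ N ∧ Below i j k s t v ∧ ∀ x ∈ N, Below i j k s t x → crd j v ≤ crd j x) ∨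
  ((∀ x ∈ N, ¬ Below i j k s t x) ∧ Nearest N j s v)

/-- The moves allowed at `s` with destination `t` when the visible vertices are `N`. -/
def Step (s t : Plane) (N : Set Plane) (v : Plane) : Prop :=
  (∃ i, t ∈ positiveCone i s ∧ Nearest N i s v) ∨
  (∃ i j k, Distinct i j k ∧ s ∈ positiveCone i t ∧ (∃ p ∈ N, Pocket j s t p) ∧
    (∃ p ∈ N, Pocket k s t p) ∧ crd j t - crd j s ≤ crd k t - crd k s ∧ Nearest N j s v) ∨
  (∃ i j k, Distinct i j k ∧ s ∈ positiveCone i t ∧ (∀ p ∈ N, ¬ Pocket k s t p) ∧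
    -- If pocket `j` is occupied, only `k` can be the empty pocket of the potential. If both are
    -- empty, the shorter side is no worse than the one the potential refers to.
    ((∃ p ∈ N, Pocket j s t p) ∨ crd j t - crd j s ≤ crd k t - crd k s) ∧ Descend i j k s t N v)

open Classical in
/-- The routing algorithm: it makes an allowed move. -/
noncomputable def router : RoutingAlgorithm := fun s t N =>
  if h : ∃ v, Step s t N v then h.choose else s

/-- The potential of the message at `s` is at most `φ`. -/
def Potential (P : Finset Plane) (s t : Plane) (φ : ℝ) : Prop :=
  (s = t ∧ 0 ≤ φ) ∨
  (∃ i j k, Distinct i j k ∧ t ∈ positiveCone i s ∧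
    crd i t - crd i s + (crd j s - crd j t) ≤ φ ∧ crd i t - crd i s + (crd k s - crd k t) ≤ φ) ∨
  (∃ i j k, Distinct i j k ∧ s ∈ positiveCone i t ∧
    2 * (crd i s - crd i t) + (crd j t - crd j s) ≤ φ) ∨
  (∃ i j k, Distinct i j k ∧ s ∈ positiveCone i t ∧ (∀ p ∈ P, ¬ Pocket k s t p) ∧
    crd i s - crd i t + (crd j t - crd j s) ≤ φ)

lemma not_mem_positiveCone_of_mem {i l : Fin 3} {s t : Plane} (h : t ∈ positiveCone i s) :
    s ∉ positiveCone l t := by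
  have hd := distinct_add i
  rw [mem_positiveCone hd] at h
  have hs := crd_sum hd s
  have ht := crd_sum hd t
  intro h'
  rcases hd.eq_or l with rfl | rfl | rfl
  · rw [mem_positiveCone hd] at h'; linarith [h.1, h'.1]
  · rw [mem_positiveCone hd.rotate] at h'; linarith [h.2, h'.1]
  · rw [mem_positiveCone hd.rotate.rotate] at h'; linarith [h.1, h'.2]

lemma positiveCone_unique {i l : Fin 3} {s t : Plane} (h : t ∈ positiveCone i s)
    (h' : t ∈ positiveCone l s) : l = i := by
  have hd := distinct_add i
  rw [mem_positiveCone hd] at h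
  have hs := crd_sum hd s
  have ht := crd_sum hd t
  rcases hd.eq_or l with rfl | rfl | rfl
  · rfl
  · rw [mem_positiveCone hd.rotate] at h'; linarith [h.1, h.2, h'.1, h'.2]
  · rw [mem_positiveCone hd.rotate.rotate] at h'; linarith [h.1, h.2, h'.1, h'.2]

lemma exists_mem_positiveCone {P : Finset Plane} (hP : GeneralPosition P) {s t : Plane}
    (hs : s ∈ P) (ht : t ∈ P) (hne : s ≠ t) :
    ∃ i, t ∈ positiveCone i s ∨ s ∈ positiveCone i t := by
  rw [generalPosition_iff] at hP
  have hd : Distinct 0 1 2 := by unfold Distinct; decide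
  have h := hP s hs t ht hne
  have e1 := crd_sum hd s
  have e2 := crd_sum hd t
  rcases lt_or_gt_of_ne (h 0) with h0 | h0 <;> rcases lt_or_gt_of_ne (h 1) with h1 | h1 <;>
    rcases lt_or_gt_of_ne (h 2) with h2 | h2
  · linarith
  · exact ⟨2, .inr ((mem_positiveCone hd.rotate.rotate).2 ⟨h0, h1⟩)⟩
  · exact ⟨1, .inr ((mem_positiveCone hd.rotate).2 ⟨h2, h0⟩)⟩
  · exact ⟨0, .inl ((mem_positiveCone hd).2 ⟨h1, h2⟩)⟩
  · exact ⟨0, .inr ((mem_positiveCone hd).2 ⟨h1, h2⟩)⟩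
  · exact ⟨1, .inl ((mem_positiveCone hd.rotate).2 ⟨h2, h0⟩)⟩
  · exact ⟨2, .inl ((mem_positiveCone hd.rotate.rotate).2 ⟨h0, h1⟩)⟩
  · linarith

/-! ### What a vertex learns from its 1-neighbourhood. -/

lemma mem_kNeighborhood_one {P : Finset Plane} {s v : Plane} :
    v ∈ kNeighborhood P 1 s ↔ v = s ∨ (halfTheta6 P).Adj s v := by
  constructor
  · rintro ⟨p, hp⟩
    cases p with
    | nil => exact .inl rfl
    | cons h q =>
      cases q with
      | nil => exact .inr h
      | cons h' q' => simp at hp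
  · rintro (rfl | h)
    · exact ⟨.nil, by simp⟩
    · exact ⟨.cons h .nil, by simp⟩

lemma self_not_mem_positiveCone (i : Fin 3) (s : Plane) : s ∉ positiveCone i s :=
  fun h => not_mem_positiveCone_of_mem h h

lemma IsClosest.adj {P : Finset Plane} {i : Fin 3} {s v : Plane} (hs : s ∈ P)
    (h : IsClosest P i s v) : (halfTheta6 P).Adj s v := by
  refine ⟨?_, hs, h.1, i, .inl h⟩
  rintro rfl
  exact self_not_mem_positiveCone i s h.2.1

lemma exists_isClosest {P : Finset Plane} {i : Fin 3} {s x : Plane} (hx : x ∈ P)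
    (h : x ∈ positiveCone i s) : ∃ v, IsClosest P i s v := by
  classical
  obtain ⟨v, hv, hmin⟩ := (P.filter (· ∈ positiveCone i s)).exists_min_image (coneDist i s)
    ⟨x, by simp [hx, h]⟩
  simp only [Finset.mem_filter] at hv hmin
  exact ⟨v, hv.1, hv.2, fun y hy hy' => hmin y ⟨hy, hy'⟩⟩

lemma mem_of_mem_kNeighborhood_one {P : Finset Plane} {s v : Plane} (hs : s ∈ P)
    (h : v ∈ kNeighborhood P 1 s) : v ∈ P := by
  rcases mem_kNeighborhood_one.1 h with rfl | h
  · exact hs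
  · exact h.2.2.1

/-- The closest vertex of `P` in a positive cone is a neighbour of `s`, hence competes among the
visible points. -/
lemma Nearest.isClosest {P : Finset Plane} {i : Fin 3} {s v : Plane} (hs : s ∈ P)
    (h : Nearest (kNeighborhood P 1 s) i s v) : IsClosest P i s v := by
  have hv := mem_of_mem_kNeighborhood_one hs h.1
  refine ⟨hv, h.2.1, fun x hx hx' => ?_⟩
  obtain ⟨y, hy⟩ := exists_isClosest hx hx'
  have h1 := h.2.2 y (mem_kNeighborhood_one.2 (.inr (hy.adj hs))) hy.2.1
  rw [coneDist_le_iff]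
  exact h1.trans ((coneDist_le_iff _ _ _ _).1 (hy.2.2 x hx hx'))

lemma IsClosest.nearest {P : Finset Plane} {i : Fin 3} {s v : Plane} (hs : s ∈ P)
    (h : IsClosest P i s v) : Nearest (kNeighborhood P 1 s) i s v :=
  ⟨mem_kNeighborhood_one.2 (.inr (h.adj hs)), h.2.1, fun x hx hxs =>
    (coneDist_le_iff _ _ _ _).1 (h.2.2 x (mem_of_mem_kNeighborhood_one hs hx) hxs)⟩

/-- A nonempty pocket is seen from `s`. -/
lemma exists_pocket_iff {P : Finset Plane} {k : Fin 3} {s t : Plane} (hs : s ∈ P) :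
    (∃ p ∈ kNeighborhood P 1 s, Pocket k s t p) ↔ ∃ p ∈ P, Pocket k s t p := by
  constructor
  · rintro ⟨p, hp, h⟩
    exact ⟨p, mem_of_mem_kNeighborhood_one hs hp, h⟩
  · rintro ⟨p, hp, h⟩
    obtain ⟨y, hy⟩ := exists_isClosest hp h.1
    exact ⟨y, mem_kNeighborhood_one.2 (.inr (hy.adj hs)), hy.2.1,
      ((coneDist_le_iff _ _ _ _).1 (hy.2.2 p hp h.1)).trans_lt h.2⟩

lemma forall_pocket_iff {P : Finset Plane} {k : Fin 3} {s t : Plane} (hs : s ∈ P) :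
    (∀ p ∈ kNeighborhood P 1 s, ¬ Pocket k s t p) ↔ ∀ p ∈ P, ¬ Pocket k s t p := by
  simpa using not_congr (exists_pocket_iff (k := k) (t := t) hs)

/-- A neighbour of `s` in a negative cone has `s` as its closest vertex. -/
lemma isClosest_of_adj {P : Finset Plane} {i : Fin 3} {s v : Plane} (h : (halfTheta6 P).Adj s v)
    (hs : s ∈ positiveCone i v) : IsClosest P i v s := by
  obtain ⟨-, -, -, l, h | h⟩ := h
  · exact absurd hs (not_mem_positiveCone_of_mem h.2.1)
  · rwa [positiveCone_unique hs h.2.1] at h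

/-- If the pocket `k` is empty and `p` lies below `s`, then `s` sees a vertex below it that is at
most as far along `j` as `p`, or the pocket `j` contains a vertex that is nearer than `p`. -/
lemma exists_below {P : Finset Plane} (hP : GeneralPosition P) {i j k : Fin 3}
    (h : Distinct i j k) {s t p : Plane} (hs : s ∈ P) (hp : p ∈ P)
    (hk : ∀ p ∈ P, ¬ Pocket k s t p) (hps : Below i j k s t p) :
    (∃ q ∈ kNeighborhood P 1 s, Below i j k s t q ∧ crd j q ≤ crd j p) ∨
    ∃ r ∈ P, Pocket j s t r ∧ crd j r < crd j p := by
  classical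
  -- The highest candidate `q` is either joined to `s` or has a closest vertex `r ≠ s` in `C_i`.
  -- Such an `r` is not in the empty pocket `k`, and by maximality of `q` not below `s`, so only
  -- pocket `j` remains.
  obtain ⟨q, hq, hmax⟩ := (P.filter (fun q => Below i j k s t q ∧ crd j q ≤ crd j p)).exists_max_image
    (crd i) ⟨p, by simp [hp, hps]⟩
  simp only [Finset.mem_filter] at hq hmax
  obtain ⟨hqP, hqB, hqj⟩ := hq
  obtain ⟨hqs, hqj', hqk⟩ := id hqB
  by_cases hadj : (halfTheta6 P).Adj s q
  · exact .inl ⟨q, mem_kNeighborhood_one.2 (.inr hadj), hqB, hqj⟩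
  right
  obtain ⟨r, hr⟩ := exists_isClosest hs hqs
  have hrs : r ≠ s := by
    rintro rfl
    exact hadj (hr.adj hqP).symm
  have hgp := generalPosition_iff.1 hP r hr.1 s hs hrs
  have hri := lt_of_le_of_ne ((coneDist_le_iff _ _ _ _).1 (hr.2.2 s hs hqs)) (hgp i)
  have hrq := hr.2.1
  rw [mem_positiveCone h] at hrq
  have er := crd_sum h r
  have es := crd_sum h s
  have eq := crd_sum h q
  have hrj : crd j s < crd j r := by
    by_contra hcon
    exact hk r hr.1 ⟨(mem_positiveCone h.rotate.rotate).2
      ⟨hri, lt_of_le_of_ne (not_lt.1 hcon) (hgp j)⟩, by linarith⟩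
  refine ⟨r, hr.1, ⟨(mem_positiveCone h.rotate).2 ⟨?_, hri⟩, by linarith⟩, by linarith⟩
  by_contra hcon
  have := hmax r ⟨hr.1, ⟨(mem_positiveCone h).2 ⟨hrj, lt_of_le_of_ne (not_lt.1 hcon) (hgp k).symm⟩,
    by linarith, by linarith⟩, by linarith⟩
  linarith

/-- A descending move keeps the pocket `k` empty and is paid for by the potential. -/
lemma Descend.spec {P : Finset Plane} (hP : GeneralPosition P) {i j k : Fin 3}
    (h : Distinct i j k) {s t v : Plane} (hs : s ∈ P) (ht : t ∈ P) (hst : s ∈ positiveCone i t)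
    (hk : ∀ p ∈ P, ¬ Pocket k s t p) (hv : Descend i j k s t (kNeighborhood P 1 s) v) :
    (halfTheta6 P).Adj s v ∧ (v = t ∨ v ∈ positiveCone i t ∧ ∀ p ∈ P, ¬ Pocket k v t p) ∧
    crd i v - crd i t + (crd j t - crd j v) + dist s v
      ≤ crd i s - crd i t + (crd j t - crd j s) := by
  have hgp := generalPosition_iff.1 hP
  have es := crd_sum h s
  have et := crd_sum h t
  have ev := crd_sum h v
  have hst' := (mem_positiveCone h).1 hst
  rcases hv with ⟨hvN, hvB, hmin⟩ | ⟨hno, hv⟩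
  · obtain ⟨hvs, hvj, hvk⟩ := id hvB
    have hvs' := (mem_positiveCone h).1 hvs
    have hvP := mem_of_mem_kNeighborhood_one hs hvN
    have hadj : (halfTheta6 P).Adj s v := by
      rcases mem_kNeighborhood_one.1 hvN with rfl | hadj
      · exact absurd hvs (self_not_mem_positiveCone _ _)
      · exact hadj
    have hcl := isClosest_of_adj hadj hvs
    have hd := dist_le h (p := v) (q := s) hvs'.1.le hvs'.2.le
    rw [dist_comm] at hd
    refine ⟨hadj, ?_, by linarith⟩
    by_cases hvt : v = t
    · exact .inl hvt
    right
    have hg := hgp v hvP t ht hvt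
    have hvj := lt_of_le_of_ne hvj (hg j)
    have hvk := lt_of_le_of_ne hvk (hg k)
    -- A point `p` in the new pocket would lie below `s` with `crd j p < crd j v`. Then
    -- `exists_below` gives either a visible vertex contradicting the choice of `v`, or a vertex `r`
    -- that is closer to `v` in `C_i` than `s`.
    refine ⟨(mem_positiveCone h).2 ⟨hvj, hvk⟩, fun p hp ⟨hpv, hpt⟩ => ?_⟩
    rw [mem_positiveCone h.rotate.rotate] at hpv
    obtain ⟨hpi, hpj⟩ := hpv
    have ep := crd_sum h p
    have hps : p ≠ s := by rintro rfl; linarith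
    have hg := hgp p hp s hs hps
    have hpj' : crd j s < crd j p := by
      by_contra hcon
      exact hk p hp ⟨(mem_positiveCone h.rotate.rotate).2 ⟨by linarith,
        lt_of_le_of_ne (not_lt.1 hcon) (hg j)⟩, hpt⟩
    have hpk : crd k s < crd k p := by
      by_contra hcon
      have := not_lt.1 hcon
      linarith
    rcases exists_below hP h hs hp hk ⟨(mem_positiveCone h).2 ⟨hpj', hpk⟩, by linarith, hpt.le⟩ with
      ⟨q, hq, hqB, hqj⟩ | ⟨r, hr, ⟨hrs, -⟩, hrj⟩
    · linarith [hmin q hq hqB]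
    · rw [mem_positiveCone h.rotate] at hrs
      have := (coneDist_le_iff _ _ _ _).1
        (hcl.2.2 r hr ((mem_positiveCone h).2 ⟨by linarith, by linarith [hrs.1]⟩))
      linarith [hrs.2]
  · have hcl := hv.isClosest hs
    have hvs := (mem_positiveCone h.rotate).1 hcl.2.1
    have hadj := hcl.adj hs
    have hd := dist_le h.rotate (p := s) (q := v) hvs.1.le hvs.2.le
    -- Applying `exists_below` to `t` itself shows that pocket `j` is occupied, so the nearest
    -- vertex of `C_j` stays in the triangle.
    have hvj : crd j v < crd j t := by
      rcases exists_below hP h hs ht hk ⟨hst, le_rfl, le_rfl⟩ with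
        ⟨q, hq, hqB, hqj⟩ | ⟨r, hr, ⟨hrs, -⟩, hrj⟩
      · exact absurd hqB (hno q hq)
      · exact ((coneDist_le_iff _ _ _ _).1 (hcl.2.2 r hr hrs)).trans_lt hrj
    refine ⟨hadj, .inr ⟨(mem_positiveCone h).2 ⟨hvj, by linarith⟩, fun p hp ⟨hpv, hpt⟩ => ?_⟩,
      by linarith⟩
    rw [mem_positiveCone h.rotate.rotate] at hpv
    obtain ⟨hpi, hpj⟩ := hpv
    have hps : p ≠ s := by rintro rfl; linarith
    have hg := hgp p hp s hs hps
    have hpj' : crd j s < crd j p := by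
      by_contra hcon
      exact hk p hp ⟨(mem_positiveCone h.rotate.rotate).2 ⟨by linarith,
        lt_of_le_of_ne (not_lt.1 hcon) (hg j)⟩, hpt⟩
    have hpk : crd k s < crd k p := by
      by_contra hcon
      have := (coneDist_le_iff _ _ _ _).1 (hcl.2.2 p hp ((mem_positiveCone h.rotate).2
        ⟨lt_of_le_of_ne (not_lt.1 hcon) (hg k), by linarith⟩))
      linarith
    rcases exists_below hP h hs hp hk ⟨(mem_positiveCone h).2 ⟨hpj', hpk⟩, by linarith, hpt.le⟩ with
      ⟨q, hq, hqB, hqj⟩ | ⟨r, hr, ⟨hrs, -⟩, hrj⟩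
    · exact hno q hq hqB
    · have := (coneDist_le_iff _ _ _ _).1 (hcl.2.2 r hr hrs)
      linarith

/-- The only doubtful case is a descent with nothing visible below `s`; there `exists_below`,
applied to `t`, supplies a vertex in pocket `j`. -/
lemma exists_step {P : Finset Plane} (hP : GeneralPosition P) {s t : Plane} (hs : s ∈ P)
    (ht : t ∈ P) (hne : s ≠ t) : ∃ v, Step s t (kNeighborhood P 1 s) v := by
  classical
  obtain ⟨i, hi | hi⟩ := exists_mem_positiveCone hP hs ht hne
  · obtain ⟨v, hv⟩ := exists_isClosest ht hi
    exact ⟨v, .inl ⟨i, hi, hv.nearest hs⟩⟩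
  have nearest : ∀ j, (∃ p ∈ kNeighborhood P 1 s, Pocket j s t p) →
      ∃ v, Nearest (kNeighborhood P 1 s) j s v := by
    rintro j ⟨p, hp, hp'⟩
    obtain ⟨v, hv⟩ := exists_isClosest (mem_of_mem_kNeighborhood_one hs hp) hp'.1
    exact ⟨v, hv.nearest hs⟩
  have descend : ∀ j k, Distinct i j k → (∀ p ∈ P, ¬ Pocket k s t p) →
      ∃ v, Descend i j k s t (kNeighborhood P 1 s) v := by
    intro j k h hk
    by_cases hB : ∃ x ∈ kNeighborhood P 1 s, Below i j k s t x
    · obtain ⟨x, hx, hxB⟩ := hB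
      obtain ⟨v, hv, hmin⟩ := (P.filter (fun q => q ∈ kNeighborhood P 1 s ∧
        Below i j k s t q)).exists_min_image (crd j)
        ⟨x, by simp [hx, hxB, mem_of_mem_kNeighborhood_one hs hx]⟩
      simp only [Finset.mem_filter] at hv hmin
      exact ⟨v, .inl ⟨hv.2.1, hv.2.2, fun y hy hyB =>
        hmin y ⟨mem_of_mem_kNeighborhood_one hs hy, hy, hyB⟩⟩⟩
    · push Not at hB
      rcases exists_below hP h hs ht hk ⟨hi, le_rfl, le_rfl⟩ with ⟨q, hq, hqB, -⟩ | ⟨r, hr, hrs, -⟩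
      · exact absurd hqB (hB q hq)
      · obtain ⟨v, hv⟩ := nearest j ((exists_pocket_iff hs).2 ⟨r, hr, hrs⟩)
        exact ⟨v, .inr ⟨hB, hv⟩⟩
  obtain ⟨j, k, h, hle⟩ : ∃ j k, Distinct i j k ∧ crd j t - crd j s ≤ crd k t - crd k s := by
    rcases le_total (crd (i + 1) t - crd (i + 1) s) (crd (i + 2) t - crd (i + 2) s) with hle | hle
    · exact ⟨_, _, distinct_add i, hle⟩
    · exact ⟨_, _, (distinct_add i).swap, hle⟩
  by_cases hj : ∃ p ∈ kNeighborhood P 1 s, Pocket j s t p <;>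
  by_cases hk : ∃ p ∈ kNeighborhood P 1 s, Pocket k s t p
  · obtain ⟨v, hv⟩ := nearest j hj
    exact ⟨v, .inr (.inl ⟨i, j, k, h, hi, hj, hk, hle, hv⟩)⟩
  · push Not at hk
    obtain ⟨v, hv⟩ := descend j k h ((forall_pocket_iff hs).1 hk)
    exact ⟨v, .inr (.inr ⟨i, j, k, h, hi, hk, .inr hle, hv⟩)⟩
  · push Not at hj
    obtain ⟨v, hv⟩ := descend k j h.swap ((forall_pocket_iff hs).1 hj)
    exact ⟨v, .inr (.inr ⟨i, k, j, h.swap, hi, hj, .inl hk, hv⟩)⟩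
  · push Not at hk
    obtain ⟨v, hv⟩ := descend j k h ((forall_pocket_iff hs).1 hk)
    exact ⟨v, .inr (.inr ⟨i, j, k, h, hi, hk, .inr hle, hv⟩)⟩

lemma router_step {P : Finset Plane} (hP : GeneralPosition P) {s t : Plane} (hs : s ∈ P)
    (ht : t ∈ P) (hne : s ≠ t) :
    Step s t (kNeighborhood P 1 s) (router s t (kNeighborhood P 1 s)) := by
  have h := exists_step hP hs ht hne
  rw [router, dif_pos h]
  exact h.choose_spec

/-- Moving to the closest vertex in the positive cone that contains the destination. -/
lemma potential_of_isClosest {P : Finset Plane} (hP : GeneralPosition P) {i j k : Fin 3}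
    (h : Distinct i j k) {s t v : Plane} (ht : t ∈ P) (hts : t ∈ positiveCone i s)
    (hv : IsClosest P i s v) {φ : ℝ} (hj : crd i t - crd i s + (crd j s - crd j t) ≤ φ)
    (hk : crd i t - crd i s + (crd k s - crd k t) ≤ φ) : Potential P v t (φ - dist s v) := by
  have es := crd_sum h s
  have et := crd_sum h t
  have ev := crd_sum h v
  have hts' := (mem_positiveCone h).1 hts
  have hvs := (mem_positiveCone h).1 hv.2.1
  have hd := dist_le h (p := s) (q := v) hvs.1.le hvs.2.le
  have hvt := (coneDist_le_iff _ _ _ _).1 (hv.2.2 t ht hts)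
  -- The overshoot: `v` has left the negative cone of `t` that contained `s` and lies in `C_j` of
  -- `t`. A point in its pocket `k` would be in `C_i` of `s` and closer to `s` than `v`.
  have side : ∀ {j k : Fin 3}, Distinct i j k → crd j v < crd j s → crd k v < crd k s →
      crd j t < crd j s → crd k t < crd k s → crd j t < crd j v → crd k v < crd k t →
      crd i v < crd i t → crd i t - crd i s + (crd j s - crd j t) ≤ φ →
      Potential P v t (φ - dist s v) := by
    intro j k h hvj hvk htj htk hj hk hi hφ
    refine .inr (.inr (.inr ⟨j, i, k, ⟨h.1.symm, h.2.2, h.2.1⟩,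
      (mem_positiveCone h.rotate).2 ⟨hk, hi⟩, fun p hp ⟨hpv, hpt⟩ => ?_, by linarith⟩))
    rw [mem_positiveCone h.rotate.rotate] at hpv
    have := (coneDist_le_iff _ _ _ _).1 (hv.2.2 p hp ((mem_positiveCone h).2
      ⟨by linarith [hpv.2], by linarith⟩))
    linarith [hpv.1]
  by_cases hne : v = t
  · subst hne
    exact .inl ⟨rfl, by linarith⟩
  have hg := generalPosition_iff.1 hP v hv.1 t ht hne
  have hi := lt_of_le_of_ne hvt (hg i)
  rcases lt_or_gt_of_ne (hg j) with hj' | hj' <;> rcases lt_or_gt_of_ne (hg k) with hk' | hk'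
  · linarith
  · exact side h.swap hvs.2 hvs.1 hts'.2 hts'.1 hk' hj' hi hk
  · exact side h hvs.1 hvs.2 hts'.1 hts'.2 hj' hk' hi hj
  · exact .inr (.inl ⟨i, j, k, h, (mem_positiveCone h).2 ⟨hj', hk'⟩, by linarith, by linarith⟩)

lemma Potential.of_negative {P : Finset Plane} {i j k : Fin 3} (h : Distinct i j k)
    {s t : Plane} {φ : ℝ} (hst : s ∈ positiveCone i t) (hφ : Potential P s t φ) :
    (2 * (crd i s - crd i t) + min (crd j t - crd j s) (crd k t - crd k s) ≤ φ) ∨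
    ((∀ p ∈ P, ¬ Pocket k s t p) ∧ crd i s - crd i t + (crd j t - crd j s) ≤ φ) ∨
    ((∀ p ∈ P, ¬ Pocket j s t p) ∧ crd i s - crd i t + (crd k t - crd k s) ≤ φ) := by
  rcases hφ with ⟨rfl, -⟩ | ⟨l, -, -, -, hl, -⟩ | ⟨l, j', k', h', hl, hφ⟩ | ⟨l, j', k', h', hl, hk, hφ⟩
  · exact absurd hst (self_not_mem_positiveCone _ _)
  · exact absurd hst (not_mem_positiveCone_of_mem hl)
  · obtain rfl := positiveCone_unique hst hl
    rcases h.eq_or_swap h' with ⟨rfl, rfl⟩ | ⟨rfl, rfl⟩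
    · exact .inl (by linarith [min_le_left (crd j' t - crd j' s) (crd k' t - crd k' s)])
    · exact .inl (by linarith [min_le_right (crd k' t - crd k' s) (crd j' t - crd j' s)])
  · obtain rfl := positiveCone_unique hst hl
    rcases h.eq_or_swap h' with ⟨rfl, rfl⟩ | ⟨rfl, rfl⟩
    · exact .inr (.inl ⟨hk, hφ⟩)
    · exact .inr (.inr ⟨hk, hφ⟩)

/-- Every allowed move follows an edge whose length is at most the loss of potential. -/
lemma Step.spec {P : Finset Plane} (hP : GeneralPosition P) {s t v : Plane} {φ : ℝ} (hs : s ∈ P)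
    (ht : t ∈ P) (hφ : Potential P s t φ) (hv : Step s t (kNeighborhood P 1 s) v) :
    (halfTheta6 P).Adj s v ∧ Potential P v t (φ - dist s v) := by
  rcases hv with ⟨i, hts, hv⟩ | ⟨i, j, k, h, hst, hj, hk, hle, hv⟩ | ⟨i, j, k, h, hst, hk, hj, hv⟩
  · have hcl := hv.isClosest hs
    refine ⟨hcl.adj hs, ?_⟩
    rcases hφ with ⟨rfl, -⟩ | ⟨l, j, k, h, hl, h1, h2⟩ | ⟨l, -, -, -, hl, -⟩ | ⟨l, -, -, -, hl, -⟩
    · exact absurd hts (self_not_mem_positiveCone _ _)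
    · obtain rfl := positiveCone_unique hts hl
      exact potential_of_isClosest hP h ht hts hcl h1 h2
    · exact absurd hl (not_mem_positiveCone_of_mem hts)
    · exact absurd hl (not_mem_positiveCone_of_mem hts)
  · have hcl := hv.isClosest hs
    refine ⟨hcl.adj hs, ?_⟩
    rw [exists_pocket_iff hs] at hj hk
    have hb : 2 * (crd i s - crd i t) + (crd j t - crd j s) ≤ φ := by
      rcases hφ.of_negative h hst with h1 | ⟨h1, -⟩ | ⟨h1, -⟩
      · rwa [min_eq_left hle] at h1
      · obtain ⟨p, hp, hp'⟩ := hk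
        exact absurd hp' (h1 p hp)
      · obtain ⟨p, hp, hp'⟩ := hj
        exact absurd hp' (h1 p hp)
    obtain ⟨p, hp, hps, hpt⟩ := hj
    have hvj := ((coneDist_le_iff _ _ _ _).1 (hcl.2.2 p hp hps)).trans_lt hpt
    have hvs := (mem_positiveCone h.rotate).1 hcl.2.1
    have hd := dist_le h.rotate (p := s) (q := v) hvs.1.le hvs.2.le
    have hst' := (mem_positiveCone h).1 hst
    exact .inr (.inr (.inl ⟨i, j, k, h, (mem_positiveCone h).2 ⟨hvj, by linarith⟩, by linarith⟩))
  · rw [forall_pocket_iff hs] at hk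
    rw [exists_pocket_iff hs] at hj
    obtain ⟨hadj, hvt, hle⟩ := hv.spec hP h hs ht hst hk
    have hst' := (mem_positiveCone h).1 hst
    have es := crd_sum h s
    have et := crd_sum h t
    have hb : crd i s - crd i t + (crd j t - crd j s) ≤ φ := by
      rcases hφ.of_negative h hst with h1 | ⟨-, h1⟩ | ⟨h1, h2⟩
      -- The general potential is at least twice the side of the triangle, which dominates the
      -- potential with an empty pocket.
      · have := le_min (sub_nonneg.2 hst'.1.le) (sub_nonneg.2 hst'.2.le)
        linarith
      · exact h1
      · rcases hj with ⟨p, hp, hp'⟩ | hj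
        · exact absurd hp' (h1 p hp)
        · linarith
    refine ⟨hadj, ?_⟩
    rcases hvt with rfl | ⟨hvt, hvk⟩
    · exact .inl ⟨rfl, by linarith⟩
    · exact .inr (.inr (.inr ⟨i, j, k, h, hvt, hvk, by linarith⟩))

/-! ### From the potential to arrival and total length. -/

lemma Potential.nonneg {P : Finset Plane} {s t : Plane} {φ : ℝ} (hφ : Potential P s t φ) :
    0 ≤ φ := by
  rcases hφ with ⟨-, h⟩ | ⟨i, j, k, h, hl, h1, -⟩ | ⟨i, j, k, h, hl, h1⟩ | ⟨i, j, k, h, hl, -, h1⟩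
  · exact h
  all_goals
    have hl := (mem_positiveCone h).1 hl
    have es := crd_sum h s
    have et := crd_sum h t
    linarith [hl.1, hl.2]

lemma position_succ (A : RoutingAlgorithm) (k : ℕ) (P : Finset Plane) (s t : Plane) (n : ℕ) :
    position A k P s t (n + 1)
      = position A k P (A s t (kNeighborhood P k s)) t n := by
  induction n with
  | zero => rfl
  | succ n ih => rw [position, ih]; rfl

lemma exists_edge_length_pos (P : Finset Plane) :
    ∃ η > 0, ∀ u ∈ P, ∀ v ∈ P, u ≠ v → η ≤ dist u v := by
  classical
  rcases P.offDiag.eq_empty_or_nonempty with he | hne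
  · refine ⟨1, one_pos, fun u hu v hv huv => ?_⟩
    have : (u, v) ∈ P.offDiag := Finset.mem_offDiag.2 ⟨hu, hv, huv⟩
    simp [he] at this
  · obtain ⟨x, hx, hmin⟩ := P.offDiag.exists_min_image (fun x => dist x.1 x.2) hne
    refine ⟨dist x.1 x.2, dist_pos.2 (Finset.mem_offDiag.1 hx).2.2, fun u hu v hv huv => ?_⟩
    exact hmin (u, v) (Finset.mem_offDiag.2 ⟨hu, hv, huv⟩)

/-- Each move costs at least the minimal distance `η` in `P`, so a nonnegative potential below `m *
η` allows fewer than `m` moves; the induction is on `m`. -/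
theorem router_arrives {P : Finset Plane} (hP : GeneralPosition P) {s t : Plane} {φ : ℝ}
    (hs : s ∈ P) (ht : t ∈ P) (hφ : Potential P s t φ) :
    ∃ n, ArrivesAfter router 1 P s t n ∧ travelled router 1 P s t n ≤ φ := by
  obtain ⟨η, hη, hmin⟩ := exists_edge_length_pos P
  obtain ⟨m, hm⟩ := exists_nat_gt (φ / η)
  rw [div_lt_iff₀ hη] at hm
  induction m generalizing s φ with
  | zero => simp at hm; linarith [hφ.nonneg]
  | succ m ih =>
    by_cases hst : s = t
    · exact ⟨0, ⟨hst, by simp⟩, by simpa [travelled] using hφ.nonneg⟩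
    obtain ⟨hadj, hpot⟩ := (router_step hP hs ht hst).spec hP hs ht hφ
    set v := router s t (kNeighborhood P 1 s) with hv
    have hd := hmin s hs v hadj.2.2.1 hadj.1
    push_cast at hm
    obtain ⟨n, ⟨hn, hn'⟩, hle⟩ := ih hadj.2.2.1 hpot (by linarith)
    refine ⟨n + 1, ⟨by rw [position_succ]; exact hn, fun j hj => ?_⟩, ?_⟩
    · rcases j with _ | j
      · exact ⟨hst, hadj⟩
      · rw [position_succ, position_succ]
        exact hn' j (by omega)
    · rw [travelled, Finset.sum_range_succ']
      simp only [position_succ _ _ _ s]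
      change travelled router 1 P v t n + dist s v ≤ φ
      linarith

theorem router_bounds {P : Finset Plane} (hP : GeneralPosition P) {u w : Plane} (hu : u ∈ P)
    (hw : w ∈ P) {i : Fin 3} (h : w ∈ positiveCone i u) :
    (∃ n : ℕ, ArrivesAfter router 1 P u w n ∧ travelled router 1 P u w n ≤ positiveBound i u w) ∧
    (∃ n : ℕ, ArrivesAfter router 1 P w u n ∧ travelled router 1 P w u n ≤ negativeBound i u w) := by
  have hd := distinct_add i
  constructor
  · apply router_arrives hP hu hw
    rw [positiveBound_eq hd h]
    exact .inr (.inl ⟨i, _, _, hd, h, by gcongr; exact le_max_left _ _,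
      by gcongr; exact le_max_right _ _⟩)
  · apply router_arrives hP hw hu
    rw [negativeBound_eq hd h, min_def]
    split_ifs
    · exact .inr (.inr (.inl ⟨i, _, _, hd, h, le_rfl⟩))
    · exact .inr (.inr (.inl ⟨i, _, _, hd.swap, h, le_rfl⟩))

end HalfThetaSix

namespace HalfThetaSix

/-! ### Lower bounds -/

lemma dist_add_dist_le_travelled (A : RoutingAlgorithm) (k : ℕ) (P : Finset Plane) (s t : Plane)
    {a b n : ℕ} (hab : a ≤ b) (hbn : b ≤ n) :
    dist s (position A k P s t a) + dist (position A k P s t a) (position A k P s t b)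
      + dist (position A k P s t b) (position A k P s t n) ≤ travelled A k P s t n := by
  set f := position A k P s t
  have h1 : dist (f 0) (f a) ≤ _ := dist_le_Ico_sum_dist f (Nat.zero_le a)
  have h2 := dist_le_Ico_sum_dist f hab
  have h3 := dist_le_Ico_sum_dist f hbn
  rw [travelled, Finset.range_eq_Ico,
    ← Finset.sum_Ico_consecutive _ (Nat.zero_le a) (hab.trans hbn),
    ← Finset.sum_Ico_consecutive _ hab hbn]
  change dist (f 0) (f a) + _ + _ ≤ _
  linarith

theorem positive_lower_bound (k : ℕ) (A : RoutingAlgorithm) {i : Fin 3} {u w : Plane}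
    (hw : w ∈ positiveCone i u) {L : ℝ} (hL : L < positiveBound i u w) :
    ∃ P : Finset Plane, GeneralPosition P ∧ u ∈ P ∧ w ∈ P ∧
      ∀ n : ℕ, ArrivesAfter A k P u w n → L < travelled A k P u w n := by
  classical
  obtain ⟨j, l, h, hle⟩ : ∃ j l, Distinct i j l ∧ crd l u - crd l w ≤ crd j u - crd j w := by
    rcases le_total (crd (i + 1) u - crd (i + 1) w) (crd (i + 2) u - crd (i + 2) w) with hle | hle
    · exact ⟨_, _, (distinct_add i).swap, hle⟩
    · exact ⟨_, _, distinct_add i, hle⟩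
  rw [positiveBound_eq h hw, max_eq_left hle] at hL
  have hw' := (mem_positiveCone h).1 hw
  have eu := crd_sum h u
  have ew := crd_sum h w
  -- The point `v` below misses the farther corner by `ε` in two coordinates; the projected legs
  -- from `u` to `v` and from `v` to `w` each lose `3 * ε / 2`.
  obtain ⟨ε, hε, hεj, hεL⟩ : ∃ ε > 0, 2 * ε < crd j u - crd j w ∧
      L < crd i w - crd i u + (crd j u - crd j w) - 3 * ε := by
    refine ⟨min ((crd j u - crd j w) / 3) ((crd i w - crd i u + (crd j u - crd j w) - L) / 4),
      lt_min (by linarith) (by linarith), ?_, ?_⟩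
    · have := min_le_left ((crd j u - crd j w) / 3)
        ((crd i w - crd i u + (crd j u - crd j w) - L) / 4)
      linarith
    · have := min_le_right ((crd j u - crd j w) / 3)
        ((crd i w - crd i u + (crd j u - crd j w) - L) / 4)
      linarith
  obtain ⟨v, hvi, hvj, hvl⟩ := exists_crd h (crd i w - ε) (crd j u - ε)
  have hvu : v ∈ positiveCone i u := (mem_positiveCone h).2 ⟨by linarith, by linarith⟩
  have hclose : ∀ x, (halfTheta6 {u, w, v}).Adj u x → x = v := by
    rintro x ⟨hne, -, hx, m, hm⟩
    simp only [Finset.mem_insert, Finset.mem_singleton] at hx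
    rcases hx with rfl | rfl | rfl
    · exact absurd rfl hne
    · rcases hm with hm | hm
      · obtain rfl := positiveCone_unique hw hm.2.1
        have := (coneDist_le_iff _ _ _ _).1 (hm.2.2 v (by simp) hvu)
        linarith
      · exact absurd hm.2.1 (not_mem_positiveCone_of_mem hw)
    · rfl
  refine ⟨{u, w, v}, ?_, by simp, by simp, ?_⟩
  · rw [generalPosition_iff]
    intro x hx y hy hxy m hm
    simp only [Finset.mem_insert, Finset.mem_singleton] at hx hy
    rcases h.eq_or m with rfl | rfl | rfl <;> rcases hx with rfl | rfl | rfl <;>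
      rcases hy with rfl | rfl | rfl <;> first | exact hxy rfl | linarith [hw'.1, hw'.2]
  · rintro (_ | n) ⟨hn, hadj⟩
    · rw [position] at hn
      subst hn
      exact absurd hw (self_not_mem_positiveCone _ _)
    · have h1 := hclose _ (hadj 0 (Nat.succ_pos n)).2
      have := dist_add_dist_le_travelled A k {u, w, v} u w (a := 1) (b := 1) (n := n + 1) le_rfl
        (by omega)
      rw [hn, show position A k {u, w, v} u w 1 = v from h1, dist_self] at this
      have d1 := le_dist h.rotate.swap v u
      have d2 := le_dist h v w
      rw [dist_comm] at d1
      linarith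

/-- A sequence of points that approach the two far corners of the canonical triangle of `u` and `w`
alternately, while descending. The points with the parity of `r` are on the side where `crd j` is
large. -/
structure Strip (i j k : Fin 3) (u w : Plane) (η : ℝ) (h : ℕ → ℝ) (p : ℕ → Plane) (r : ℕ) :
    Prop where
  distinct : Distinct i j k
  mono : StrictMono h
  zero : h 0 = 0
  lt : ∀ m, h m < η
  small_left : 2 * η < crd j u - crd j w
  small_right : 2 * η < crd k u - crd k w
  height : ∀ m, crd i (p m) = crd i w - h m
  left : ∀ m, m % 2 = r % 2 → crd j (p m) = crd j u - (η - h m) / 2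
  right : ∀ m, m % 2 ≠ r % 2 → crd k (p m) = crd k u - (η - h m) / 2

/-! ### The half-`θ₆`-graph of a strip. -/

namespace Strip

variable {i j k : Fin 3} {u w : Plane} {η : ℝ} {h : ℕ → ℝ} {p : ℕ → Plane} {r : ℕ}

lemma shift (S : Strip i j k u w η h p r) : Strip i k j u w η h p (r + 1) :=
  ⟨S.distinct.swap, S.mono, S.zero, S.lt, S.small_right, S.small_left, S.height,
    fun m hm => S.right m (by omega), fun m hm => S.left m (by omega)⟩

/-- The parity class on the side of `crd j` can be chosen. -/
lemma exists_parity (S : Strip i j k u w η h p r) (m : ℕ) :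
    ∃ s t, Strip i s t u w η h p m := by
  by_cases hm : m % 2 = r % 2
  · exact ⟨j, k, S.distinct, S.mono, S.zero, S.lt, S.small_left, S.small_right, S.height,
      fun n hn => S.left n (by omega), fun n hn => S.right n (by omega)⟩
  · exact ⟨k, j, S.distinct.swap, S.mono, S.zero, S.lt, S.small_right, S.small_left, S.height,
      fun n hn => S.right n (by omega), fun n hn => S.left n (by omega)⟩

lemma pos (S : Strip i j k u w η h p r) {m : ℕ} (hm : 1 ≤ m) : 0 < h m := by
  rw [← S.zero]; exact S.mono (by omega)

/-- All coordinates of the points on the side of `crd j`. -/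
lemma crd_left (S : Strip i j k u w η h p r) {m : ℕ} (hm : m % 2 = r % 2) :
    crd i (p m) = crd i w - h m ∧ crd j (p m) = crd j u - (η - h m) / 2 ∧
    crd k (p m) = crd k u - (crd i w - crd i u) + (η + h m) / 2 := by
  have e := crd_sum S.distinct (p m)
  have eu := crd_sum S.distinct u
  have h1 := S.height m
  have h2 := S.left m hm
  exact ⟨h1, h2, by linarith⟩

lemma crd_right (S : Strip i j k u w η h p r) {m : ℕ} (hm : m % 2 ≠ r % 2) :
    crd i (p m) = crd i w - h m ∧ crd k (p m) = crd k u - (η - h m) / 2 ∧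
    crd j (p m) = crd j u - (crd i w - crd i u) + (η + h m) / 2 :=
  S.shift.crd_left (by omega)

/-- The point sets of the lower bound. -/
noncomputable def pts (u w : Plane) (p : ℕ → Plane) (M : ℕ) : Finset Plane :=
  open Classical in {u, w} ∪ (Finset.Icc 1 M).image p

lemma mem_pts {x : Plane} {M : ℕ} :
    x ∈ pts u w p M ↔ x = u ∨ x = w ∨ ∃ m, 1 ≤ m ∧ m ≤ M ∧ x = p m := by
  simp only [pts, Finset.mem_union, Finset.mem_insert, Finset.mem_singleton, Finset.mem_image,
    Finset.mem_Icc]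
  grind

lemma point_mem_pts {M m : ℕ} (h1 : 1 ≤ m) (h2 : m ≤ M) : p m ∈ pts u w p M :=
  mem_pts.2 (.inr (.inr ⟨m, h1, h2, rfl⟩))

lemma mem_cone (S : Strip i j k u w η h p r) {m : ℕ} (hm : 1 ≤ m) : p m ∈ positiveCone i u := by
  obtain ⟨s, t, S⟩ := S.exists_parity m
  obtain ⟨h0, h1, h2⟩ := S.crd_left rfl
  have := S.lt m
  have := S.pos hm
  have := S.small_left
  have := S.small_right
  have eu := crd_sum S.distinct u
  have ew := crd_sum S.distinct w
  exact (mem_positiveCone S.distinct).2 ⟨by linarith, by linarith⟩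

lemma apex_cone (S : Strip i j k u w η h p r) : w ∈ positiveCone i u := by
  have := S.lt 0
  have := S.zero
  have := S.small_left
  have := S.small_right
  exact (mem_positiveCone S.distinct).2 ⟨by linarith, by linarith⟩

lemma injective (S : Strip i j k u w η h p r) {m m' : ℕ} (hm : p m = p m') : m = m' := by
  have h1 := S.height m
  have h2 := S.height m'
  rw [hm, h2] at h1
  exact S.mono.injective (by linarith)

lemma point_ne_apex (S : Strip i j k u w η h p r) {m : ℕ} (hm : 1 ≤ m) : p m ≠ w := by
  intro e
  have h1 := S.height m
  rw [e] at h1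
  linarith [S.pos hm]

lemma point_ne_base (S : Strip i j k u w η h p r) {m : ℕ} (hm : 1 ≤ m) : p m ≠ u := by
  intro e
  have := S.mem_cone hm
  rw [e] at this
  exact self_not_mem_positiveCone _ _ this

lemma crd_ne_of_lt (S : Strip i j k u w η h p r) {m m' : ℕ} (hm : m < m') (l : Fin 3) :
    crd l (p m) ≠ crd l (p m') := by
  obtain ⟨s, t, S⟩ := S.exists_parity m
  obtain ⟨a0, a1, a2⟩ := S.crd_left rfl
  have := S.lt m
  have := S.lt m'
  have := S.mono hm
  have := S.small_left
  have := S.small_right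
  have := S.mono.monotone (Nat.zero_le m)
  have := S.zero
  have eu := crd_sum S.distinct u
  have ew := crd_sum S.distinct w
  intro e
  by_cases hpar : m' % 2 = m % 2
  · obtain ⟨b0, b1, b2⟩ := S.crd_left hpar
    rcases S.distinct.eq_or l with rfl | rfl | rfl <;> linarith
  · obtain ⟨b0, b1, b2⟩ := S.crd_right hpar
    rcases S.distinct.eq_or l with rfl | rfl | rfl <;> linarith

lemma crd_ne_apex (S : Strip i j k u w η h p r) {m : ℕ} (hm : 1 ≤ m) (l : Fin 3) :
    crd l (p m) ≠ crd l w := by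
  obtain ⟨s, t, S⟩ := S.exists_parity m
  obtain ⟨a0, a1, a2⟩ := S.crd_left rfl
  have := S.lt m
  have := S.pos hm
  have := S.small_left
  have := S.small_right
  have eu := crd_sum S.distinct u
  have ew := crd_sum S.distinct w
  intro e
  rcases S.distinct.eq_or l with rfl | rfl | rfl <;> linarith

lemma crd_ne_of_mem_positiveCone {i : Fin 3} {u v : Plane} (hv : v ∈ positiveCone i u)
    (l : Fin 3) : crd l v ≠ crd l u := by
  have hd := distinct_add i
  have eu := crd_sum hd u
  have ev := crd_sum hd v
  rw [mem_positiveCone hd] at hv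
  intro e
  rcases hd.eq_or l with rfl | rfl | rfl <;> linarith [hv.1, hv.2]

lemma generalPosition (S : Strip i j k u w η h p r) (M : ℕ) : GeneralPosition (pts u w p M) := by
  rw [generalPosition_iff]
  intro x hx y hy hxy l
  rcases mem_pts.1 hx with rfl | rfl | ⟨m, hm, -, rfl⟩ <;>
    rcases mem_pts.1 hy with rfl | rfl | ⟨m', hm', -, rfl⟩
  · exact absurd rfl hxy
  · exact (crd_ne_of_mem_positiveCone S.apex_cone l).symm
  · exact (crd_ne_of_mem_positiveCone (S.mem_cone hm') l).symm
  · exact crd_ne_of_mem_positiveCone S.apex_cone l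
  · exact absurd rfl hxy
  · exact (S.crd_ne_apex hm' l).symm
  · exact crd_ne_of_mem_positiveCone (S.mem_cone hm) l
  · exact S.crd_ne_apex hm l
  · rcases lt_trichotomy m m' with hlt | rfl | hlt
    · exact S.crd_ne_of_lt hlt l
    · exact absurd rfl hxy
    · exact (S.crd_ne_of_lt hlt l).symm

/-- The only neighbour of `u` is the last point. -/
lemma adj_base (S : Strip i j k u w η h p r) {M : ℕ} (hM : 1 ≤ M) {x : Plane}
    (hx : (halfTheta6 (pts u w p M)).Adj x u) : x = p M := by
  obtain ⟨hne, hxP, -, l, hl⟩ := hx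
  have hcone : x ∈ positiveCone i u := by
    rcases mem_pts.1 hxP with rfl | rfl | ⟨m, hm, -, rfl⟩
    · exact absurd rfl hne
    · exact S.apex_cone
    · exact S.mem_cone hm
  rcases hl with hl | hl
  · exact absurd hl.2.1 (not_mem_positiveCone_of_mem hcone)
  obtain rfl := positiveCone_unique hcone hl.2.1
  have h1 := (coneDist_le_iff _ _ _ _).1 (hl.2.2 _ (point_mem_pts hM le_rfl) (S.mem_cone hM))
  rw [S.height] at h1
  rcases mem_pts.1 hxP with rfl | rfl | ⟨m, hm, hmM, rfl⟩
  · exact absurd rfl hne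
  · linarith [S.pos hM]
  · rw [S.height] at h1
    have := S.mono.le_iff_le.1 (show h M ≤ h m by linarith)
    rw [show m = M by omega]

/-- The neighbours of `w` are the first two points. -/
lemma adj_apex (S : Strip i j k u w η h p r) {M : ℕ} (hM : 2 ≤ M) {y : Plane}
    (hy : (halfTheta6 (pts u w p M)).Adj w y) : y = p 1 ∨ y = p 2 := by
  obtain ⟨hne, -, hyP, l, hl⟩ := hy
  rcases mem_pts.1 hyP with rfl | rfl | ⟨m, hm, hmM, rfl⟩
  · rcases hl with hl | hl
    · exact absurd hl.2.1 (not_mem_positiveCone_of_mem S.apex_cone)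
    · obtain rfl := positiveCone_unique S.apex_cone hl.2.1
      have h1 := (coneDist_le_iff _ _ _ _).1
        (hl.2.2 _ (point_mem_pts (m := 1) le_rfl (by omega)) (S.mem_cone le_rfl))
      rw [S.height] at h1
      linarith [S.pos le_rfl]
  · exact absurd rfl hne
  obtain ⟨s, t, S⟩ := S.exists_parity m
  have hcone : ∀ n, 1 ≤ n → n % 2 = m % 2 → p n ∈ positiveCone s w := by
    intro n hn hpar
    obtain ⟨a0, a1, a2⟩ := S.crd_left hpar
    have := S.lt n
    have := S.pos hn
    have := S.small_left
    have eu := crd_sum S.distinct u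
    have ew := crd_sum S.distinct w
    exact (mem_positiveCone S.distinct.rotate).2 ⟨by linarith, by linarith⟩
  rcases hl with hl | hl
  · obtain rfl := positiveCone_unique (hcone m hm rfl) hl.2.1
    have key : ∀ n, 1 ≤ n → n ≤ 2 → n % 2 = m % 2 → p m = p n := by
      intro n hn hn2 hpar
      have h1 := (coneDist_le_iff _ _ _ _).1
        (hl.2.2 _ (point_mem_pts hn (by omega)) (hcone n hn hpar))
      rw [S.left n hpar, S.left m rfl] at h1
      have := S.mono.le_iff_le.1 (show h m ≤ h n by linarith)
      rw [show m = n by omega]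
    rcases Nat.mod_two_eq_zero_or_one m with h0 | h0
    · exact .inr (key 2 (by norm_num) le_rfl (by omega))
    · exact .inl (key 1 le_rfl (by norm_num) (by omega))
  · exact absurd hl.2.1 (not_mem_positiveCone_of_mem (hcone m hm rfl))

/-- On its own side, `p m` has the earlier points in its cone `C_i`, the closest being `p (m - 2)`.
On the other side, it has the later points in a positive cone, the closest being `p (m + 1)`. In the
remaining cases `p m` lies in a positive cone of `p m'`. -/
lemma index_le_of_isClosest (S : Strip i j k u w η h p r) {M m m' : ℕ} (hm : 1 ≤ m) (hm' : 1 ≤ m')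
    (hM : m ≤ M) (hM' : m' ≤ M) {l : Fin 3} (hl : IsClosest (pts u w p M) l (p m) (p m')) :
    m' ≤ m + 2 ∧ m ≤ m' + 2 := by
  obtain ⟨s, t, S⟩ := S.exists_parity m
  have eu := crd_sum S.distinct u
  have ew := crd_sum S.distinct w
  obtain ⟨a0, a1, a2⟩ := S.crd_left rfl
  have hsl := S.small_left
  have hsr := S.small_right
  have hη := S.lt m
  have hpos := S.pos hm
  have hpos' := S.pos hm'
  have hη' := S.lt m'
  by_cases hpar : m' % 2 = m % 2
  · have cone : ∀ n, n % 2 = m % 2 → n < m → p n ∈ positiveCone i (p m) := by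
      intro n hn hlt
      have := S.mono hlt
      obtain ⟨b0, b1, b2⟩ := S.crd_left hn
      exact (mem_positiveCone S.distinct).2 ⟨by linarith, by linarith⟩
    obtain ⟨b0, b1, b2⟩ := S.crd_left hpar
    rcases lt_trichotomy m m' with hlt | rfl | hlt
    · have := S.mono hlt
      exact absurd hl.2.1 (not_mem_positiveCone_of_mem (i := i)
        ((mem_positiveCone S.distinct).2 ⟨by linarith, by linarith⟩))
    · omega
    · obtain rfl := positiveCone_unique (cone m' hpar hlt) hl.2.1
      by_contra hcon
      have h1 := (coneDist_le_iff _ _ _ _).1 (hl.2.2 _ (point_mem_pts (m := m - 2) (by omega)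
        (by omega)) (cone (m - 2) (by omega) (by omega)))
      rw [S.height, S.height] at h1
      have := S.mono.le_iff_le.1 (show h (m - 2) ≤ h m' by linarith)
      omega
  · have cone : ∀ n, n % 2 ≠ m % 2 → m < n → p n ∈ positiveCone t (p m) := by
      intro n hn hlt
      have := S.mono hlt
      have := S.lt n
      obtain ⟨b0, b1, b2⟩ := S.crd_right hn
      exact (mem_positiveCone S.distinct.rotate.rotate).2 ⟨by linarith, by linarith⟩
    obtain ⟨b0, b1, b2⟩ := S.crd_right hpar
    rcases lt_trichotomy m m' with hlt | rfl | hlt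
    · obtain rfl := positiveCone_unique (cone m' hpar hlt) hl.2.1
      by_contra hcon
      have h1 := (coneDist_le_iff _ _ _ _).1 (hl.2.2 _ (point_mem_pts (m := m + 1) (by omega)
        (by omega)) (cone (m + 1) (by omega) (by omega)))
      rw [S.right _ hpar, S.right (m + 1) (by omega)] at h1
      have := S.mono.le_iff_le.1 (show h m' ≤ h (m + 1) by linarith)
      omega
    · omega
    · have := S.mono hlt
      exact absurd hl.2.1 (not_mem_positiveCone_of_mem (i := s)
        ((mem_positiveCone S.distinct.rotate).2 ⟨by linarith, by linarith⟩))

/-- Adding one more point does not change the edges among the points other than `u`. -/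
lemma adj_succ_iff (S : Strip i j k u w η h p r) {M : ℕ} {x y : Plane}
    (hx : x ∈ pts u w p M) (hxu : x ≠ u) (hy : y ∈ pts u w p M) (hyu : y ≠ u) :
    (halfTheta6 (pts u w p (M + 1))).Adj x y ↔ (halfTheta6 (pts u w p M)).Adj x y := by
  have hsub : ∀ z ∈ pts u w p M, z ∈ pts u w p (M + 1) := by
    intro z hz
    rcases mem_pts.1 hz with rfl | rfl | ⟨m, hm, hmM, rfl⟩
    · exact mem_pts.2 (.inl rfl)
    · exact mem_pts.2 (.inr (.inl rfl))
    · exact point_mem_pts hm (by omega)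
  obtain ⟨s, t, S⟩ := S.exists_parity (M + 1)
  -- Apart from `u`, the new point has the smallest `crd i` and the largest `crd s`. It is therefore
  -- in no cone `C_i` or `C_t` of these points and is never the closest in `C_s`.
  have extreme : ∀ z ∈ pts u w p M, z ≠ u →
      crd i (p (M + 1)) < crd i z ∧ crd s z < crd s (p (M + 1)) := by
    intro z hz hzu
    have eu := crd_sum S.distinct u
    have ew := crd_sum S.distinct w
    obtain ⟨a0, a1, a2⟩ := S.crd_left (m := M + 1) rfl
    have := S.small_left
    have := S.small_right
    have := S.lt (M + 1)
    have := S.pos (m := M + 1) (by omega)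
    rcases mem_pts.1 hz with rfl | rfl | ⟨m, hm, hmM, rfl⟩
    · exact absurd rfl hzu
    · constructor <;> linarith
    · have := S.lt m
      have := S.mono (show m < M + 1 by omega)
      by_cases hpar : m % 2 = (M + 1) % 2
      · obtain ⟨b0, b1, b2⟩ := S.crd_left hpar
        constructor <;> linarith
      · obtain ⟨b0, b1, b2⟩ := S.crd_right hpar
        constructor <;> linarith
  have closest : ∀ x ∈ pts u w p M, x ≠ u → ∀ y ∈ pts u w p M, y ≠ u → ∀ l,
      (IsClosest (pts u w p (M + 1)) l x y ↔ IsClosest (pts u w p M) l x y) := by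
    intro x hx hxu y hy hyu l
    refine ⟨fun hl => ⟨hy, hl.2.1, fun z hz => hl.2.2 z (hsub z hz)⟩,
      fun hl => ⟨hsub y hy, hl.2.1, fun z hz hzx => ?_⟩⟩
    by_cases hzM : z ∈ pts u w p M
    · exact hl.2.2 z hzM hzx
    obtain rfl : z = p (M + 1) := by
      rcases mem_pts.1 hz with rfl | rfl | ⟨m, hm, hmM, rfl⟩
      · exact absurd (mem_pts.2 (.inl rfl)) hzM
      · exact absurd (mem_pts.2 (.inr (.inl rfl))) hzM
      · by_cases h' : m ≤ M
        · exact absurd (point_mem_pts hm h') hzM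
        · rw [show m = M + 1 by omega]
    obtain ⟨x1, x2⟩ := extreme x hx hxu
    rw [coneDist_le_iff]
    rcases S.distinct.eq_or l with rfl | rfl | rfl
    · rw [mem_positiveCone S.distinct] at hzx
      linarith [hzx.1]
    · exact (extreme y hy hyu).2.le
    · rw [mem_positiveCone S.distinct.rotate.rotate] at hzx
      linarith [hzx.2]
  constructor
  · rintro ⟨hne, -, -, l, hl⟩
    exact ⟨hne, hx, hy, l, hl.imp (closest x hx hxu y hy hyu l).1 (closest y hy hyu x hx hxu l).1⟩
  · rintro ⟨hne, -, -, l, hl⟩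
    exact ⟨hne, hsub x hx, hsub y hy, l,
      hl.imp (closest x hx hxu y hy hyu l).2 (closest y hy hyu x hx hxu l).2⟩

/-- The vertices that can be reached from `w` in `n` steps. -/
lemma adj_near (S : Strip i j k u w η h p r) {M n : ℕ} (hM : 2 * n + 2 ≤ M) {x y : Plane}
    (hx : x = w ∨ ∃ m, 1 ≤ m ∧ m ≤ 2 * n ∧ x = p m) (hxy : (halfTheta6 (pts u w p M)).Adj x y) :
    y = w ∨ ∃ m, 1 ≤ m ∧ m ≤ 2 * (n + 1) ∧ y = p m := by
  rcases hx with rfl | ⟨m, hm, hmn, rfl⟩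
  · rcases S.adj_apex (by omega) hxy with rfl | rfl
    · exact .inr ⟨1, le_rfl, by omega, rfl⟩
    · exact .inr ⟨2, by omega, by omega, rfl⟩
  · rcases mem_pts.1 hxy.2.2.1 with rfl | rfl | ⟨m', hm', hmM', rfl⟩
    · have := S.injective (S.adj_base (by omega) hxy)
      omega
    · exact .inl rfl
    · refine .inr ⟨m', hm', ?_, rfl⟩
      obtain ⟨-, -, -, l, hl | hl⟩ := hxy
      · have := (S.index_le_of_isClosest hm hm' (by omega) hmM' hl).1
        omega
      · have := (S.index_le_of_isClosest hm' hm hmM' (by omega) hl).2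
        omega

lemma near_mem (S : Strip i j k u w η h p r) {M n : ℕ} (hM : 2 * n ≤ M) {x : Plane}
    (hx : x = w ∨ ∃ m, 1 ≤ m ∧ m ≤ 2 * n ∧ x = p m) : x ∈ pts u w p M ∧ x ≠ u := by
  rcases hx with rfl | ⟨m, hm, hmn, rfl⟩
  · refine ⟨mem_pts.2 (.inr (.inl rfl)), ?_⟩
    rintro rfl
    exact self_not_mem_positiveCone _ _ S.apex_cone
  · exact ⟨point_mem_pts hm (by omega), S.point_ne_base hm⟩

/-- Each step raises the index by at most two, so a walk of length at most `K` from `w` stays among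
`w` and the first `2 * K` points and misses `u`; only the edges among these matter. -/
lemma kNeighborhood_subset (S : Strip i j k u w η h p r) {M M' K : ℕ} (hM : 2 * K ≤ M)
    (hadj : ∀ x ∈ pts u w p (2 * K), x ≠ u → ∀ y ∈ pts u w p (2 * K), y ≠ u →
      (halfTheta6 (pts u w p M)).Adj x y → (halfTheta6 (pts u w p M')).Adj x y) :
    kNeighborhood (pts u w p M) K w ⊆ kNeighborhood (pts u w p M') K w := by
  have key : ∀ (L n : ℕ) (x v : Plane) (q : (halfTheta6 (pts u w p M)).Walk x v),
      q.length = L → n + L ≤ K → (x = w ∨ ∃ m, 1 ≤ m ∧ m ≤ 2 * n ∧ x = p m) →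
      ∃ q' : (halfTheta6 (pts u w p M')).Walk x v, q'.length = L := by
    intro L
    induction L with
    | zero =>
      intro n x v q hq _ _
      cases q with
      | nil => exact ⟨.nil, rfl⟩
      | cons _ _ => simp at hq
    | succ L ih =>
      intro n x v q hq hn hx
      cases q with
      | nil => simp at hq
      | cons hxy q =>
        have hy := S.adj_near (n := n) (by omega) hx hxy
        obtain ⟨q', hq'⟩ := ih (n + 1) _ _ q (by simpa using hq) (by omega) hy
        obtain ⟨x1, x2⟩ := S.near_mem (M := 2 * K) (by omega) hx
        obtain ⟨y1, y2⟩ := S.near_mem (M := 2 * K) (by omega) hy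
        exact ⟨.cons (hadj _ x1 x2 _ y1 y2 hxy) q', by simp [hq']⟩
  rintro v ⟨q, hq⟩
  obtain ⟨q', hq'⟩ := key q.length 0 w v q rfl (by omega) (.inl rfl)
  exact ⟨q', by omega⟩

lemma kNeighborhood_succ (S : Strip i j k u w η h p r) {M K : ℕ} (hM : 2 * K ≤ M) :
    kNeighborhood (pts u w p (M + 1)) K w = kNeighborhood (pts u w p M) K w := by
  have hsub : ∀ z ∈ pts u w p (2 * K), z ∈ pts u w p M := by
    intro z hz
    rcases mem_pts.1 hz with rfl | rfl | ⟨m, hm, hmM, rfl⟩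
    · exact mem_pts.2 (.inl rfl)
    · exact mem_pts.2 (.inr (.inl rfl))
    · exact point_mem_pts hm (by omega)
  apply Set.Subset.antisymm
  · exact S.kNeighborhood_subset (by omega) fun x hx hxu y hy hyu =>
      (S.adj_succ_iff (hsub x hx) hxu (hsub y hy) hyu).1
  · exact S.kNeighborhood_subset hM fun x hx hxu y hy hyu =>
      (S.adj_succ_iff (hsub x hx) hxu (hsub y hy) hyu).2

/-- If the first move goes to one side and the last point is on the other side, the path is long. -/
lemma lt_travelled (S : Strip i j k u w η h p r) {A : RoutingAlgorithm} {K M c : ℕ} {L : ℝ}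
    (hM : 1 ≤ M) (hc : 1 ≤ c) (hcM : c % 2 ≠ M % 2)
    (hL : L < 2 * (crd i w - crd i u) + min (crd j u - crd j w) (crd k u - crd k w) - 4 * η)
    (hA : A w u (kNeighborhood (pts u w p M) K w) = p c) {n : ℕ}
    (hn : ArrivesAfter A K (pts u w p M) w u n) : L < travelled A K (pts u w p M) w u n := by
  obtain ⟨s, t, S', hmin⟩ : ∃ s t, Strip i s t u w η h p c ∧
      min (crd j u - crd j w) (crd k u - crd k w) ≤ crd s u - crd s w := by
    obtain ⟨s, t, S'⟩ := S.exists_parity c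
    refine ⟨s, t, S', ?_⟩
    rcases S.distinct.eq_or_swap S'.distinct with ⟨rfl, rfl⟩ | ⟨rfl, rfl⟩
    · exact min_le_left _ _
    · exact min_le_right _ _
  rcases n with _ | n
  · have e : w = u := hn.1
    have := S.apex_cone
    rw [e] at this
    exact absurd this (self_not_mem_positiveCone _ _)
  have hlast := (hn.2 n (by omega)).2
  rw [hn.1] at hlast
  have hlast := S.adj_base hM hlast
  have hn1 : 1 ≤ n := by
    rcases n with _ | n
    · exact absurd hlast.symm (S.point_ne_apex hM)
    · omega
  have htr := dist_add_dist_le_travelled A K (pts u w p M) w u hn1 (Nat.le_succ n)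
  have hfirst : position A K (pts u w p M) w u 1 = p c := hA
  rw [hlast, hn.1, hfirst] at htr
  obtain ⟨a0, a1, a2⟩ := S'.crd_left (m := c) rfl
  obtain ⟨b0, b1, b2⟩ := S'.crd_right (m := M) hcM.symm
  have eu := crd_sum S'.distinct u
  have ew := crd_sum S'.distinct w
  -- The legs from `w` to the wrong corner, across to `p M`, and down to `u` have lengths close to
  -- `crd s u - crd s w`, `D` and `D`, where `D = crd i w - crd i u`; the total loss is below `4 *
  -- η`.
  have d1 := le_dist S'.distinct (p c) w
  rw [dist_comm] at d1
  have d2 := le_dist S'.distinct (p c) (p M)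
  have d3 := le_dist S'.distinct.rotate.rotate (p M) u
  have := S'.lt c
  have := S'.lt M
  have := S'.pos hc
  have := S'.pos hM
  linarith

end Strip

lemma exists_strip {i j k : Fin 3} (hd : Distinct i j k) {u w : Plane} {η : ℝ} (hη : 0 < η)
    (hj : 2 * η < crd j u - crd j w) (hk : 2 * η < crd k u - crd k w) :
    ∃ h p, Strip i j k u w η h p 1 := by
  classical
  -- Any strictly increasing sequence from `0` that stays below `η` would do. For even `m`, the
  -- prescribed `crd k` is encoded through `crd j = -crd i - crd k`.
  set h : ℕ → ℝ := fun m => η - η / (m + 1) with hh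
  choose p hp using fun m : ℕ => exists_crd hd (crd i w - h m) (if m % 2 = 1 then
    crd j u - (η - h m) / 2 else -(crd i w - h m) - (crd k u - (η - h m) / 2))
  refine ⟨h, p, hd, ?_, by simp [hh], fun m => ?_, hj, hk, fun m => (hp m).1,
    fun m hm => ?_, fun m hm => ?_⟩
  · intro a b hab
    have : η / ((b : ℝ) + 1) < η / ((a : ℝ) + 1) := by gcongr
    simp only [hh]
    linarith
  · have : 0 < η / ((m : ℝ) + 1) := by positivity
    simp only [hh]
    linarith
  · rw [(hp m).2.1, if_pos (by omega)]
  · rw [(hp m).2.2, if_neg (by omega)]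
    ring

theorem negative_lower_bound (K : ℕ) (A : RoutingAlgorithm) {i : Fin 3} {u w : Plane}
    (hw : w ∈ positiveCone i u) {L : ℝ} (hL : L < negativeBound i u w) :
    ∃ P : Finset Plane, GeneralPosition P ∧ u ∈ P ∧ w ∈ P ∧
      ∀ n : ℕ, ArrivesAfter A K P w u n → L < travelled A K P w u n := by
  have hd := distinct_add i
  have hw' := (mem_positiveCone hd).1 hw
  rw [negativeBound_eq hd hw] at hL
  obtain ⟨η, hη, hη'⟩ : ∃ η > 0, η < min (min ((crd (i + 1) u - crd (i + 1) w) / 2)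
      ((crd (i + 2) u - crd (i + 2) w) / 2)) ((2 * (crd i w - crd i u) +
        min (crd (i + 1) u - crd (i + 1) w) (crd (i + 2) u - crd (i + 2) w) - L) / 4) :=
    exists_between (lt_min (lt_min (by linarith [hw'.1]) (by linarith [hw'.2])) (by linarith))
  simp only [lt_min_iff] at hη'
  obtain ⟨⟨h1, h2⟩, h3⟩ := hη'
  obtain ⟨h, p, S⟩ := exists_strip (u := u) (w := w) hd hη (by linarith) (by linarith)
  have hN := S.kNeighborhood_succ (M := 2 * K + 2) (K := K) (by omega)
  have mem : ∀ M, u ∈ Strip.pts u w p M ∧ w ∈ Strip.pts u w p M := fun M =>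
    ⟨Strip.mem_pts.2 (.inl rfl), Strip.mem_pts.2 (.inr (.inl rfl))⟩
  -- `A` makes the same first move with `2 * K + 2` and with `2 * K + 3` points. If it goes to `p
  -- 2`, the odd last index is on the other side. If not, the even last index is chosen, and a
  -- message that arrives must start with `p 1`.
  by_cases hA : A w u (kNeighborhood (Strip.pts u w p (2 * K + 2)) K w) = p 2
  · exact ⟨_, S.generalPosition (2 * K + 2 + 1), (mem _).1, (mem _).2, fun n hn =>
      S.lt_travelled (by omega) (by norm_num) (by omega) (by linarith) (hN ▸ hA) hn⟩
  refine ⟨_, S.generalPosition (2 * K + 2), (mem _).1, (mem _).2, fun n hn => ?_⟩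
  rcases n with _ | n
  · have e : w = u := hn.1
    rw [e] at hw
    exact absurd hw (self_not_mem_positiveCone _ _)
  rcases S.adj_apex (by omega) (hn.2 0 (Nat.succ_pos n)).2 with h' | h'
  · exact S.lt_travelled (by omega) le_rfl (by omega) (by linarith) h' hn
  · exact absurd h' hA

end HalfThetaSix

theorem mainTheorem1 :
    -- a deterministic 1-local 0-memory algorithm that attains both bounds on every instance
    (∃ A : RoutingAlgorithm, ∀ P : Finset Plane, GeneralPosition P →
      ∀ u ∈ P, ∀ w ∈ P, ∀ i : Fin 3, w ∈ positiveCone i u →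
        (∃ n : ℕ, ArrivesAfter A 1 P u w n ∧ travelled A 1 P u w n ≤ positiveBound i u w) ∧
        (∃ n : ℕ, ArrivesAfter A 1 P w u n ∧ travelled A 1 P w u n ≤ negativeBound i u w)) ∧
    -- no k-local 0-memory algorithm does better: for every pair `u`, `w` and every `L` below the
    -- bound, on some instance the message does not arrive within distance `L`
    (∀ (k : ℕ) (A : RoutingAlgorithm) (i : Fin 3) (u w : Plane), w ∈ positiveCone i u →
      (∀ L < positiveBound i u w, ∃ P : Finset Plane, GeneralPosition P ∧ u ∈ P ∧ w ∈ P ∧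
        ∀ n : ℕ, ArrivesAfter A k P u w n → L < travelled A k P u w n) ∧
      (∀ L < negativeBound i u w, ∃ P : Finset Plane, GeneralPosition P ∧ u ∈ P ∧ w ∈ P ∧
        ∀ n : ℕ, ArrivesAfter A k P w u n → L < travelled A k P w u n)) :=
  ⟨⟨router, fun _ hP _ hu _ hw _ h => router_bounds hP hu hw h⟩, fun k A _ _ _ h =>
    ⟨fun _ hL => positive_lower_bound k A h hL, fun _ hL => negative_lower_bound k A h hL⟩⟩
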